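/- Let $n^{(1)},n^{(2)},n^{(3)}\in\mathbb R^3$ be orthonormal and let $\mathcal O$ be the cubic group with these axes, i.e. the group of the 24 rotations $Q\in\mathrm{SO}(3)$ that map each $n^{(i)}$ to some $\pm n^{(j)}$. For $F\in\mathrm{GL}^+(3)$ put $C=F^TF$ and $G=\operatorname{cof}C=\det(C)\,C^{-T}$; thus $C$ ranges over the symmetric positive definite $3\times3$ matrices. Write $A:B=\sum_{ij}A_{ij}B_{ij}$, $x_i=n^{(i)}\otimes n^{(i)}:C$ and $g_i=n^{(i)}\otimes n^{(i)}:G$, and define $$I_1=\sum_{i=1}^3x_i^2,\quad I_2=\sum_{i=1}^3x_i^3,\quad I_3=\sum_{i=1}^3(x_i+g_i)^2,\quad I_4=\sum_{i=1}^3g_i^2,\quad I_5=\sum_{i=1}^3(x_i^2+g_i)^2,\quad I_6=\sum_{i=1}^3g_i^3,$$ $$I_1^{\rm iso}=\operatorname{tr}C,\qquad I_2^{\rm iso}=\operatorname{tr}G,\qquad I_3^{\rm iso}=\det C.$$ With $\mathbb M=\sum_{i=1}^3n^{(i)}\otimes n^{(i)}\otimes n^{(i)}\otimes n^{(i)}$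 and $(\mathbb M:A)_{ij}=\sum_{kl}\mathbb M_{ijkl}A_{kl}$, let $$J_1=\operatorname{tr}(\mathbb M:C)^2,\quad J_2=\operatorname{tr}(\mathbb M:C)^3,\quad J_3=\operatorname{tr}\big(C^2(\mathbb M:C)\big),$$ $$J_4=\operatorname{tr}(\mathbb M:C^2)^2,\quad J_5=\operatorname{tr}\big(C^2(\mathbb M:C)^2\big),\quad J_6=\operatorname{tr}\big(C(\mathbb M:C^2)^2\big),$$ and $J_k^{\rm iso}=\operatorname{tr}C^k$ for $k=1,2,3$. A function of $C$ is called *polyconvex* if, as a function of $F\in\mathrm{GL}^+(3)$, it equals $\mathcal P(F,\operatorname{cof}F,\det F)$ for some convex $\mathcal P:\mathbb R^{3\times3}\times\mathbb R^{3\times3}\times\mathbb R\to\mathbb R$. A real function $f$ of $C$ is an *invariant* of $\mathcal O$ if $f(QCQ^T)=f(C)$ for all $C$ and all $Q\in\mathcal O$. A tuple of invariants is a *functional basis* if every invariant of $\mathcal O$ is a function of the tuple; a tuple of polynomial invariants is an *integrity basis* if every invariant that is a polynomial in the entries of $C$ is a polynomial in the tuple. Then: 1. The nine functions $I_1,\dots,I_6,I_1^{\rm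 iso},I_2^{\rm iso},I_3^{\rm iso}$ are polyconvex, are polynomial in the entries of $C$, and are invariants of $\mathcal O$. They are polynomials in $J_1,\dots,J_6,J_1^{\rm iso},J_2^{\rm iso},J_3^{\rm iso}$. 2. $J_1,\dots,J_5$ and $J_1^{\rm iso},J_2^{\rm iso},J_3^{\rm iso}$ are polynomials in these nine functions. 3. $J_6$ is not a polynomial in these nine functions, but it can be expressed through them with a division by $I_1^{\rm iso}=\operatorname{tr}C>0$: with $$k=\tfrac12(I_3-I_1-I_4),\qquad q=\tfrac16(I_1^{\rm iso})^4-(I_1^{\rm iso})^2I_1+\tfrac43I_1^{\rm iso}I_2+\tfrac12I_1^2,\qquad m=\tfrac12(I_5-q-I_4),$$ $$\begin{aligned}J_6={}&(I_1^{\rm iso})^2I_2-I_2^{\rm iso}k+2\big(I_1^{\rm iso}m-I_1^{\rm iso}I_2^{\rm iso}I_1\big)+\tfrac12\big(3I_3^{\rm iso}I_1-(I_1^{\rm iso})^2I_3^{\rm iso}\big)+\tfrac14\big(3I_1^{\rm iso}(I_2^{\rm iso})^2+I_1^{\rm iso}I_4\big)\\&+\frac1{I_1^{\rm iso}}\Big[-I_3^{\rm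 iso}I_2-I_6-I_2^{\rm iso}m+\tfrac12\big(3I_2^{\rm iso}I_4-(I_2^{\rm iso})^3+3I_3^{\rm iso}k\big)+\tfrac14\big(k^2+(I_2^{\rm iso})^2I_1-3(I_3^{\rm iso})^2-I_1I_4\big)\Big].\end{aligned}$$ 4. The tuple $(I_1,\dots,I_6,I_1^{\rm iso},I_2^{\rm iso},I_3^{\rm iso})$ is a functional basis, but not an integrity basis, for $\mathcal O$. -/

import Mathlib

open scoped Matrix

/-- Second-order tensors on `ℝ³`. -/
abbrev Tensor2 : Type := Matrix (Fin 3) (Fin 3) ℝ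

/-- Fourth-order tensors on `ℝ³`. -/
abbrev Tensor4 : Type := Fin 3 → Fin 3 → Fin 3 → Fin 3 → ℝ

namespace Cubic

/-- `A : B = A_{ij} B_{ij}`. -/
def ddot (A B : Tensor2) : ℝ := ∑ i, ∑ j, A i j * B i j

/-- `(𝕄 : A)_{ij} = 𝕄_{ijkl} A_{kl}`. -/
def contract (M : Tensor4) (A : Tensor2) : Tensor2 :=
  Matrix.of fun i j => ∑ k, ∑ l, M i j k l * A k l

/-- The cofactor matrix; for invertible `A` it is `det A • A⁻ᵀ`, see `cof_eq`. -/
def cof (A : Tensor2) : Tensor2 := A.adjugateᵀ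

theorem cof_eq (A : Tensor2) (hA : A.det ≠ 0) : cof A = A.det • (A⁻¹)ᵀ := by
  rw [cof, Matrix.inv_def, Ring.inverse_eq_inv', Matrix.transpose_smul, smul_smul,
    mul_inv_cancel₀ hA, one_smul]

/-- Deformation gradients: `GL⁺(3)`. -/
def GLPos : Set Tensor2 := {F | 0 < F.det}

/-- Right Cauchy-Green tensors: symmetric positive definite second-order tensors. -/
def SymPos : Set Tensor2 := {C | C.PosDef}

/-- A function of `C = Fᵀ F` is polyconvex if, as a function of the deformation gradient
`F ∈ GL⁺(3)`, it is a convex function of `(F, cof F, det F)`. -/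
def IsPolyconvex (f : Tensor2 → ℝ) : Prop :=
  ∃ P : Tensor2 × Tensor2 × ℝ → ℝ, ConvexOn ℝ Set.univ P ∧
    ∀ F ∈ GLPos, f (Fᵀ * F) = P (F, cof F, F.det)

/-- `f` is an invariant of the symmetry group `G`: it is unchanged under `C ↦ Q C Qᵀ`,
that is, under `F ↦ F Qᵀ`, for all `Q ∈ G`. -/
def IsInvariant (G : Set Tensor2) (f : Tensor2 → ℝ) : Prop :=
  ∀ Q ∈ G, ∀ C ∈ SymPos, f (Q * C * Qᵀ) = f C

/-- An invariant which is a polynomial in the coordinates of `C`. -/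
def IsPolynomialInvariant (G : Set Tensor2) (f : Tensor2 → ℝ) : Prop :=
  IsInvariant G f ∧ ∃ p : MvPolynomial (Fin 3 × Fin 3) ℝ,
    ∀ C ∈ SymPos, f C = MvPolynomial.eval (fun ij => C ij.1 ij.2) p

/-- On right Cauchy-Green tensors, `f` is a polynomial in the functions `I i`. -/
def IsPolynomialIn {ι : Type} (I : ι → Tensor2 → ℝ) (f : Tensor2 → ℝ) : Prop :=
  ∃ p : MvPolynomial ι ℝ, ∀ C ∈ SymPos, f C = MvPolynomial.eval (fun i => I i C) p

/-- A tuple of polynomial invariants in which every polynomial invariant is a polynomial. -/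
def IsIntegrityBasis {ι : Type} (G : Set Tensor2) (I : ι → Tensor2 → ℝ) : Prop :=
  (∀ i, IsPolynomialInvariant G (I i)) ∧ ∀ f, IsPolynomialInvariant G f → IsPolynomialIn I f

/-- A tuple of invariants of which every invariant is a function. -/
def IsFunctionalBasis {ι : Type} (G : Set Tensor2) (I : ι → Tensor2 → ℝ) : Prop :=
  (∀ i, IsInvariant G (I i)) ∧
    ∀ f, IsInvariant G f → ∃ ψ : (ι → ℝ) → ℝ, ∀ C ∈ SymPos, f C = ψ (fun i => I i C)

/-- The cubic group `𝒪` with axes `n⁽¹⁾, n⁽²⁾, n⁽³⁾`: the (24) rotations which map every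
axis direction to plus or minus an axis direction. -/
def groupO (n : Fin 3 → Fin 3 → ℝ) : Set Tensor2 :=
  {Q | Qᵀ * Q = 1 ∧ Q.det = 1 ∧ ∀ i, ∃ j, Q *ᵥ n i = n j ∨ Q *ᵥ n i = -n j}

/-- The cubic structural tensor `∑ᵢ n⁽ⁱ⁾ ⊗ n⁽ⁱ⁾ ⊗ n⁽ⁱ⁾ ⊗ n⁽ⁱ⁾`. -/
def Mcub (n : Fin 3 → Fin 3 → ℝ) : Tensor4 :=
  fun i j k l => ∑ a, n a i * n a j * n a k * n a l

/-- General isotropic invariants `J₁, J₂, J₃` (indices shifted to start at `0`). -/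
def Jiso : Fin 3 → Tensor2 → ℝ :=
  ![fun C => C.trace, fun C => (C ^ 2).trace, fun C => (C ^ 3).trace]

/-- Polyconvex isotropic invariants `tr C`, `tr G`, `det C` with `G = cof C`. -/
def Iiso : Fin 3 → Tensor2 → ℝ :=
  ![fun C => C.trace, fun C => (cof C).trace, fun C => C.det]

/-- General cubic invariants `J₁, …, J₆` (indices shifted to start at `0`). -/
def Jcub (n : Fin 3 → Fin 3 → ℝ) : Fin 6 → Tensor2 → ℝ :=
  ![fun C => (contract (Mcub n) C ^ 2).trace,
    fun C => (contract (Mcub n) C ^ 3).trace,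
    fun C => (C ^ 2 * contract (Mcub n) C).trace,
    fun C => (contract (Mcub n) (C ^ 2) ^ 2).trace,
    fun C => (C ^ 2 * contract (Mcub n) C ^ 2).trace,
    fun C => (C * contract (Mcub n) (C ^ 2) ^ 2).trace]

/-- `n⁽ⁱ⁾ ⊗ n⁽ⁱ⁾ : A`. -/
def proj (n : Fin 3 → Fin 3 → ℝ) (i : Fin 3) (A : Tensor2) : ℝ :=
  ddot (Matrix.vecMulVec (n i) (n i)) A

/-- The six cubic invariants `I₁, …, I₆` (indices shifted to start at `0`). -/
def Icub (n : Fin 3 → Fin 3 → ℝ) : Fin 6 → Tensor2 → ℝ :=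
  ![fun C => ∑ i, proj n i C ^ 2,
    fun C => ∑ i, proj n i C ^ 3,
    fun C => ∑ i, (proj n i C + proj n i (cof C)) ^ 2,
    fun C => ∑ i, proj n i (cof C) ^ 2,
    fun C => ∑ i, (proj n i C ^ 2 + proj n i (cof C)) ^ 2,
    fun C => ∑ i, proj n i (cof C) ^ 3]

/-- The nine invariants `I₁, …, I₆` (cubic) and `tr C, tr G, det C`. -/
def Iall (n : Fin 3 → Fin 3 → ℝ) : Fin 6 ⊕ Fin 3 → Tensor2 → ℝ := Sum.elim (Icub n) Iiso

/-- The nine invariants `J₁, …, J₆` (cubic) and `tr C, tr C², tr C³`. -/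
def Jall (n : Fin 3 → Fin 3 → ℝ) : Fin 6 ⊕ Fin 3 → Tensor2 → ℝ := Sum.elim (Jcub n) Jiso

/-- The expression, with a division by `t₁ = tr C`, for the sixth general cubic invariant in
terms of the values `c₁, …, c₆` of the six cubic invariants and `t₁, t₂, t₃` of
`tr C, tr G, det C`. -/
noncomputable def sixthRep (c₁ c₂ c₃ c₄ c₅ c₆ t₁ t₂ t₃ : ℝ) : ℝ :=
  let k := (c₃ - c₁ - c₄) / 2
  let q := t₁ ^ 4 / 6 - t₁ ^ 2 * c₁ + 4 / 3 * t₁ * c₂ + c₁ ^ 2 / 2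
  let m := (c₅ - q - c₄) / 2
  t₁ ^ 2 * c₂ - t₂ * k + 2 * (t₁ * m - t₁ * t₂ * c₁) + (3 * t₃ * c₁ - t₁ ^ 2 * t₃) / 2
    + (3 * t₁ * t₂ ^ 2 + t₁ * c₄) / 4
    + 1 / t₁ * (-t₃ * c₂ - c₆ - t₂ * m + (3 * t₂ * c₄ - t₂ ^ 3 + 3 * t₃ * k) / 2
      + (k ^ 2 + t₂ ^ 2 * c₁ - 3 * t₃ ^ 2 - c₁ * c₄) / 4)

end Cubic

/-!
In the frame `n` a symmetric tensor has a diagonal `x` and off-diagonal entries `y`, and the cubic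
group acts by permuting the axes and changing signs. With `g` the diagonal of the cofactor matrix
and `w` that of the square, `Iall` is built from `x`, `g` and `Jall` from `x`, `w`
(`Iall_eq_Icoord`, `Jall_eq_Jcoord`). The Cayley-Hamilton theorem gives
`wᵢ = gᵢ + (tr C) xᵢ - tr G`, so the two families are compared through the joint moments of `x`
and `g`, with Newton's identity for `∑ xᵢ⁴` (`isPolynomialIn_Jall`, `isPolynomialIn_Iall`). The
formula for the sixth general invariant is an identity of rational functions in the six
coordinates (`Jcoord_sixth_eq`).

*Polyconvexity.* `xᵢ = |F nᵢ|²` and `gᵢ = |(cof F) nᵢ|²` are nonnegative convex functions, and the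
nine functions are sums of powers, of exponent at least one, of nonnegative convex functions,
together with `det C = (det F)²`.

*Functional basis.* The moments `∑ xᵢ`, `∑ gᵢ`, `∑ xᵢ²`, ..., `∑ gᵢ³` of degree at most three are
determined by the nine functions; for `∑ xᵢ gᵢ²` this uses the formula for the sixth general
invariant. Hence for each `l` the three numbers `xᵢ + l gᵢ` are determined up to a permutation, and
since there are finitely many permutations, some permutation serves two values of `l`, thus the
pairs `(xᵢ, gᵢ)` (`exists_perm_of_moments`). Then the squares of the `yᵢ` are determined, and by
`det C` also their product, which leaves only sign changes realised by the cubic group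
(`exists_mem_groupO_of_Iall_eq`).

*The sixth general invariant is not a polynomial in the nine functions.* A polynomial relation
would persist over `ℂ[s]` (`aeval_Icoord_eq_of_isPolynomialIn`). For a primitive third root of
unity `w` take `x = s (1, w, w²)` and `y = s (1, w², w)`: then `tr C`, `tr G` and `∑ xᵢ²` vanish,
so that the nine functions have only terms of degree `3` and `4` in `s`, whereas the sixth general
invariant is `3 s⁵`, and `5` is not a sum of threes and fours. Being a polynomial invariant, it
also shows that the nine functions are not an integrity basis.
-/

open scoped Matrix

namespace Cubic

/-! ### Symmetric tensors in the cubic frame -/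

section SymMat

variable {R : Type*}

/-- The symmetric matrix with diagonal `x` and off-diagonal entries `y`, where `y i` is the entry
in the row and the column different from `i`. -/
def symMat (x y : Fin 3 → R) : Matrix (Fin 3) (Fin 3) R :=
  !![x 0, y 2, y 1; y 2, x 1, y 0; y 1, y 0, x 2]

theorem symMat_diag (x y : Fin 3 → R) (i : Fin 3) : symMat x y i i = x i := by
  fin_cases i <;> rfl

theorem symMat_offDiag (x y : Fin 3 → R) (i : Fin 3) : symMat x y (i + 1) (i + 2) = y i := by
  fin_cases i <;> rfl

theorem transpose_symMat (x y : Fin 3 → R) : (symMat x y)ᵀ = symMat x y := by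
  ext i j
  fin_cases i <;> fin_cases j <;> rfl

theorem eq_symMat {A : Matrix (Fin 3) (Fin 3) R} (hA : Aᵀ = A) :
    A = symMat (fun i => A i i) (fun i => A (i + 1) (i + 2)) := by
  have h : ∀ i j, A j i = A i j := fun i j => congrFun (congrFun hA i) j
  ext i j
  fin_cases i <;> fin_cases j <;> first | rfl | exact h _ _

end SymMat

section Coordinates

variable {R S : Type*} [CommRing R] [CommRing S]

/-- The diagonal entries of the cofactor matrix of `symMat x y`. -/
def cofDiag (x y : Fin 3 → R) (i : Fin 3) : R := x (i + 1) * x (i + 2) - y i ^ 2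

/-- The diagonal entries of the square of `symMat x y`. -/
def sqDiag (x y : Fin 3 → R) (i : Fin 3) : R := x i ^ 2 + y (i + 1) ^ 2 + y (i + 2) ^ 2

/-- The determinant of `symMat x y`. -/
def detCoord (x y : Fin 3 → R) : R :=
  x 0 * x 1 * x 2 + 2 * (y 0 * y 1 * y 2) - ∑ i, x i * y i ^ 2

/-- The nine invariants `Iall`, in the coordinates given by `symMat`; a general commutative ring
is allowed so that they can also be evaluated at polynomials and at complex matrices. -/
def Icoord (x y : Fin 3 → R) : Fin 6 ⊕ Fin 3 → R :=
  Sum.elim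
    ![∑ i, x i ^ 2, ∑ i, x i ^ 3, ∑ i, (x i + cofDiag x y i) ^ 2, ∑ i, cofDiag x y i ^ 2,
      ∑ i, (x i ^ 2 + cofDiag x y i) ^ 2, ∑ i, cofDiag x y i ^ 3]
    ![∑ i, x i, ∑ i, cofDiag x y i, detCoord x y]

/-- The nine invariants `Jall`, in the coordinates given by `symMat`. -/
def Jcoord (x y : Fin 3 → R) : Fin 6 ⊕ Fin 3 → R :=
  Sum.elim
    ![∑ i, x i ^ 2, ∑ i, x i ^ 3, ∑ i, x i * sqDiag x y i, ∑ i, sqDiag x y i ^ 2,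
      ∑ i, x i ^ 2 * sqDiag x y i, ∑ i, x i * sqDiag x y i ^ 2]
    ![∑ i, x i, ∑ i, sqDiag x y i,
      (∑ i, x i ^ 3) + 3 * (∑ i, x i * (y (i + 1) ^ 2 + y (i + 2) ^ 2)) + 6 * (y 0 * y 1 * y 2)]

theorem map_Icoord (f : R →+* S) (x y : Fin 3 → R) (a : Fin 6 ⊕ Fin 3) :
    f (Icoord x y a) = Icoord (fun i => f (x i)) (fun i => f (y i)) a := by
  rcases a with a | a <;> fin_cases a <;>
    simp [Icoord, cofDiag, detCoord, map_sum, map_ofNat f 2]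

theorem map_Jcoord_sixth (f : R →+* S) (x y : Fin 3 → R) :
    f (Jcoord x y (.inl 5)) = Jcoord (fun i => f (x i)) (fun i => f (y i)) (.inl 5) := by
  simp [Jcoord, sqDiag, map_sum]

theorem symMat_sq_diag (x y : Fin 3 → R) (i : Fin 3) : (symMat x y ^ 2) i i = sqDiag x y i := by
  fin_cases i <;> simp [symMat, pow_two, sqDiag, Matrix.mul_apply, Fin.sum_univ_three] <;> ring

theorem trace_symMat_cube (x y : Fin 3 → R) :
    (symMat x y ^ 3).trace = Jcoord x y (.inr 2) := by
  simp [symMat, pow_succ, Jcoord, Matrix.trace, Fin.sum_univ_three]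
  ring

theorem det_symMat (x y : Fin 3 → R) : (symMat x y).det = detCoord x y := by
  simp [symMat, Matrix.det_fin_three, detCoord, Fin.sum_univ_three]
  ring

end Coordinates

theorem cof_symMat_diag (x y : Fin 3 → ℝ) (i : Fin 3) :
    cof (symMat x y) i i = cofDiag x y i := by
  fin_cases i <;> simp [cof, symMat, Matrix.adjugate_fin_three, cofDiag] <;> ring

section Frame

variable {n : Fin 3 → Fin 3 → ℝ}

/-- The matrix of the tensor `A` in the frame `n`. -/
def toFrame (n : Fin 3 → Fin 3 → ℝ) (A : Tensor2) : Tensor2 :=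
  Matrix.of n * A * (Matrix.of n)ᵀ

theorem of_mul_transpose (hn : ∀ i j, n i ⬝ᵥ n j = if i = j then 1 else 0) :
    Matrix.of n * (Matrix.of n)ᵀ = 1 := by
  ext i j
  rw [Matrix.one_apply, ← hn i j]
  rfl

theorem transpose_mul_of (hn : ∀ i j, n i ⬝ᵥ n j = if i = j then 1 else 0) :
    (Matrix.of n)ᵀ * Matrix.of n = 1 :=
  mul_eq_one_comm.mp (of_mul_transpose hn)

theorem det_mul_self_of_orthogonal {Q : Tensor2} (hQ : Qᵀ * Q = 1) : Q.det * Q.det = 1 := by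
  simpa using congrArg Matrix.det hQ

theorem cof_mul (A B : Tensor2) : cof (A * B) = cof A * cof B := by
  simp [cof, Matrix.adjugate_mul_distrib]

theorem cof_transpose (A : Tensor2) : cof Aᵀ = (cof A)ᵀ := by
  simp [cof, Matrix.adjugate_transpose]

theorem cof_of_orthogonal {Q : Tensor2} (hQ : Qᵀ * Q = 1) : cof Q = Q.det • Q := by
  have h : Q.adjugate = Q.det • Qᵀ := by
    calc Q.adjugate = Qᵀ * Q * Q.adjugate := by rw [hQ, one_mul]
      _ = Q.det • Qᵀ := by rw [mul_assoc, Matrix.mul_adjugate, Matrix.mul_smul, mul_one]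
  rw [cof, h, Matrix.transpose_smul, Matrix.transpose_transpose]

theorem cof_conj {Q : Tensor2} (hQ : Qᵀ * Q = 1) (A : Tensor2) :
    cof (Q * A * Qᵀ) = Q * cof A * Qᵀ := by
  rw [cof_mul, cof_mul, cof_transpose, cof_of_orthogonal hQ]
  simp [smul_smul, det_mul_self_of_orthogonal hQ]

theorem conj_mul {Q : Tensor2} (hQ : Qᵀ * Q = 1) (A B : Tensor2) :
    Q * (A * B) * Qᵀ = Q * A * Qᵀ * (Q * B * Qᵀ) := by
  calc Q * (A * B) * Qᵀ = Q * A * 1 * B * Qᵀ := by simp only [mul_one, mul_assoc]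
    _ = _ := by rw [← hQ]; simp only [mul_assoc]

theorem trace_conj {Q : Tensor2} (hQ : Qᵀ * Q = 1) (A : Tensor2) :
    (Q * A * Qᵀ).trace = A.trace := by
  rw [Matrix.trace_mul_comm, ← mul_assoc, hQ, one_mul]

theorem det_conj {Q : Tensor2} (hQ : Qᵀ * Q = 1) (A : Tensor2) :
    (Q * A * Qᵀ).det = A.det := by
  rw [Matrix.det_mul, Matrix.det_mul, Matrix.det_transpose, mul_right_comm,
    det_mul_self_of_orthogonal hQ, one_mul]

theorem proj_eq_toFrame (i : Fin 3) (A : Tensor2) : proj n i A = toFrame n A i i := by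
  simp [proj, ddot, toFrame, Matrix.vecMulVec_apply, Matrix.mul_apply, Fin.sum_univ_three]
  ring

theorem proj_eq_dotProduct (i : Fin 3) (A : Tensor2) : proj n i A = n i ⬝ᵥ A *ᵥ n i := by
  simp [proj, ddot, Matrix.vecMulVec_apply, Matrix.mulVec, dotProduct, Fin.sum_univ_three]
  ring

theorem sum_proj (hn : ∀ i j, n i ⬝ᵥ n j = if i = j then 1 else 0) (A : Tensor2) :
    ∑ i, proj n i A = A.trace := by
  rw [← trace_conj (transpose_mul_of hn) A]
  simp [proj_eq_toFrame, toFrame, Matrix.trace]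

theorem contract_Mcub (A : Tensor2) :
    contract (Mcub n) A =
      (Matrix.of n)ᵀ * Matrix.diagonal (fun i => proj n i A) * Matrix.of n := by
  ext i j
  simp [contract, Mcub, proj, ddot, Matrix.vecMulVec_apply, Matrix.mul_apply,
    Matrix.diagonal_apply, Fin.sum_univ_three]
  ring

theorem toFrame_contract (hn : ∀ i j, n i ⬝ᵥ n j = if i = j then 1 else 0) (A : Tensor2) :
    toFrame n (contract (Mcub n) A) = Matrix.diagonal (fun i => proj n i A) := by
  rw [contract_Mcub, toFrame, mul_assoc, mul_assoc, of_mul_transpose hn, mul_one, ← mul_assoc,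
    of_mul_transpose hn, one_mul]

theorem toFrame_pow (hn : ∀ i j, n i ⬝ᵥ n j = if i = j then 1 else 0) (A : Tensor2) (k : ℕ) :
    toFrame n (A ^ k) = toFrame n A ^ k := by
  induction k with
  | zero => simp [toFrame, of_mul_transpose hn]
  | succ k ih => rw [pow_succ, pow_succ, ← ih]; exact conj_mul (transpose_mul_of hn) _ _

theorem Jcub_sixth (hn : ∀ i j, n i ⬝ᵥ n j = if i = j then 1 else 0) (C : Tensor2) :
    Jcub n 5 C = ∑ i, proj n i C * proj n i (C ^ 2) ^ 2 := by
  have hN := transpose_mul_of hn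
  change (C * contract (Mcub n) (C ^ 2) ^ 2).trace = _
  rw [← trace_conj hN, conj_mul hN]
  change (toFrame n C * toFrame n (contract (Mcub n) (C ^ 2) ^ 2)).trace = _
  rw [toFrame_pow hn, toFrame_contract hn, Matrix.diagonal_pow]
  simp [Matrix.trace, Matrix.mul_diagonal, proj_eq_toFrame]

theorem transpose_of_mem_SymPos {C : Tensor2} (hC : C ∈ SymPos) : Cᵀ = C := by
  have := hC.isHermitian
  rwa [Matrix.IsHermitian, Matrix.conjTranspose_eq_transpose_of_trivial] at this

theorem exists_toFrame_eq_symMat {C : Tensor2} (hC : C ∈ SymPos) :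
    ∃ x y, toFrame n C = symMat x y :=
  ⟨_, _, eq_symMat (by
    simp [toFrame, Matrix.transpose_mul, transpose_of_mem_SymPos hC, mul_assoc])⟩

variable {C : Tensor2} {x y : Fin 3 → ℝ}

theorem Iall_eq_Icoord (hn : ∀ i j, n i ⬝ᵥ n j = if i = j then 1 else 0)
    (hC : toFrame n C = symMat x y) (a : Fin 6 ⊕ Fin 3) : Iall n a C = Icoord x y a := by
  have hx : ∀ i, proj n i C = x i := fun i => by rw [proj_eq_toFrame, hC, symMat_diag]
  have hg : ∀ i, proj n i (cof C) = cofDiag x y i := fun i => by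
    rw [proj_eq_toFrame, toFrame, ← cof_conj (transpose_mul_of hn), ← cof_symMat_diag, ← hC]
    rfl
  have hd : C.det = detCoord x y := by
    rw [← det_symMat, ← hC]
    exact (det_conj (transpose_mul_of hn) C).symm
  rcases a with a | a <;> fin_cases a <;>
    simp [Iall, Icub, Iiso, Icoord, hx, hg, hd, ← sum_proj hn]

theorem Jall_eq_Jcoord (hn : ∀ i j, n i ⬝ᵥ n j = if i = j then 1 else 0)
    (hC : toFrame n C = symMat x y) (a : Fin 6 ⊕ Fin 3) : Jall n a C = Jcoord x y a := by
  have hN := transpose_mul_of hn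
  have hx : ∀ i, proj n i C = x i := fun i => by rw [proj_eq_toFrame, hC, symMat_diag]
  have hw : ∀ i, proj n i (C ^ 2) = sqDiag x y i := fun i => by
    rw [proj_eq_toFrame, toFrame_pow hn, hC, symMat_sq_diag]
  have htr : ∀ A : Tensor2, A.trace = (toFrame n A).trace := fun A => (trace_conj hN A).symm
  have hmul : ∀ A B, toFrame n (A * B) = toFrame n A * toFrame n B := conj_mul hN
  have h2 : ∀ i, (symMat x y ^ 2) i i = sqDiag x y i := symMat_sq_diag x y
  have h3 : (C ^ 3).trace = Jcoord x y (.inr 2) := by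
    rw [htr, toFrame_pow hn, hC, trace_symMat_cube]
  rcases a with a | a
  · by_cases ha : a = 5
    · subst ha
      simp only [Jall, Sum.elim_inl, Jcub_sixth hn, hx, hw]
      rfl
    · fin_cases a
      · change (contract (Mcub n) C ^ 2).trace = ∑ i, x i ^ 2
        rw [htr, toFrame_pow hn, toFrame_contract hn, Matrix.diagonal_pow, Matrix.trace_diagonal]
        simp [hx]
      · change (contract (Mcub n) C ^ 3).trace = ∑ i, x i ^ 3
        rw [htr, toFrame_pow hn, toFrame_contract hn, Matrix.diagonal_pow, Matrix.trace_diagonal]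
        simp [hx]
      · change (C ^ 2 * contract (Mcub n) C).trace = ∑ i, x i * sqDiag x y i
        rw [htr, hmul, toFrame_pow hn, toFrame_contract hn, hC]
        simp [Matrix.trace, Matrix.mul_diagonal, hx, h2, mul_comm]
      · change (contract (Mcub n) (C ^ 2) ^ 2).trace = ∑ i, sqDiag x y i ^ 2
        rw [htr, toFrame_pow hn, toFrame_contract hn, Matrix.diagonal_pow, Matrix.trace_diagonal]
        simp [hw]
      · change (C ^ 2 * contract (Mcub n) C ^ 2).trace = ∑ i, x i ^ 2 * sqDiag x y i
        rw [htr, hmul, toFrame_pow hn, toFrame_pow hn, toFrame_contract hn, Matrix.diagonal_pow,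
          hC]
        simp [Matrix.trace, Matrix.mul_diagonal, hx, h2, mul_comm]
      · exact absurd rfl ha
  · fin_cases a
    · simp [Jall, Jiso, Jcoord, ← sum_proj hn, hx]
    · simp [Jall, Jiso, Jcoord, ← sum_proj hn, hw]
    · exact h3

end Frame

/-! ### Polynomial relations between the two families -/

theorem Jcoord_sixth_eq (x y : Fin 3 → ℝ) (h : ∑ i, x i ≠ 0) :
    Jcoord x y (.inl 5) =
      sixthRep (Icoord x y (.inl 0)) (Icoord x y (.inl 1)) (Icoord x y (.inl 2))
          (Icoord x y (.inl 3)) (Icoord x y (.inl 4)) (Icoord x y (.inl 5))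
          (Icoord x y (.inr 0)) (Icoord x y (.inr 1)) (Icoord x y (.inr 2)) := by
  simp only [Fin.sum_univ_three] at h
  simp [Icoord, Jcoord, sixthRep, cofDiag, detCoord, sqDiag, Fin.sum_univ_three]
  field_simp
  ring

section PolynomialIn

variable {ι : Type} {I : ι → Tensor2 → ℝ} {f g : Tensor2 → ℝ}

theorem IsPolynomialIn.apply (I : ι → Tensor2 → ℝ) (i : ι) : IsPolynomialIn I (I i) :=
  ⟨MvPolynomial.X i, fun C _ => by simp⟩

theorem IsPolynomialIn.add (hf : IsPolynomialIn I f) (hg : IsPolynomialIn I g) :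
    IsPolynomialIn I (f + g) := by
  obtain ⟨p, hp⟩ := hf
  obtain ⟨q, hq⟩ := hg
  exact ⟨p + q, fun C hC => by simp [hp C hC, hq C hC]⟩

theorem IsPolynomialIn.mul (hf : IsPolynomialIn I f) (hg : IsPolynomialIn I g) :
    IsPolynomialIn I (f * g) := by
  obtain ⟨p, hp⟩ := hf
  obtain ⟨q, hq⟩ := hg
  exact ⟨p * q, fun C hC => by simp [hp C hC, hq C hC]⟩

theorem IsPolynomialIn.smul (r : ℝ) (hf : IsPolynomialIn I f) : IsPolynomialIn I (r • f) := by
  obtain ⟨p, hp⟩ := hf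
  exact ⟨r • p, fun C hC => by simp [hp C hC, MvPolynomial.smul_eval]⟩

theorem IsPolynomialIn.sub (hf : IsPolynomialIn I f) (hg : IsPolynomialIn I g) :
    IsPolynomialIn I (f - g) := by
  simpa [sub_eq_add_neg] using hf.add (hg.smul (-1))

theorem IsPolynomialIn.pow (hf : IsPolynomialIn I f) (k : ℕ) : IsPolynomialIn I (f ^ k) := by
  obtain ⟨p, hp⟩ := hf
  exact ⟨p ^ k, fun C hC => by simp [hp C hC]⟩

theorem IsPolynomialIn.congr (hf : IsPolynomialIn I f) (h : ∀ C ∈ SymPos, g C = f C) :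
    IsPolynomialIn I g := by
  obtain ⟨p, hp⟩ := hf
  exact ⟨p, fun C hC => by rw [h C hC, hp C hC]⟩

end PolynomialIn

section Relations

variable {n : Fin 3 → Fin 3 → ℝ}

/-- To express a function polynomially on the symmetric positive definite tensors, it suffices to
compare the two sides in the coordinates of the cubic frame. -/
theorem IsPolynomialIn.congr_coord {ι : Type} {K : ι → Tensor2 → ℝ} {f g : Tensor2 → ℝ}
    (hn : ∀ i j, n i ⬝ᵥ n j = if i = j then 1 else 0) (hf : IsPolynomialIn K f)
    (h : ∀ C x y, (∀ a, Iall n a C = Icoord x y a) → (∀ a, Jall n a C = Jcoord x y a) →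
      g C = f C) : IsPolynomialIn K g :=
  hf.congr fun C hC => by
    obtain ⟨x, y, hxy⟩ := exists_toFrame_eq_symMat (n := n) hC
    exact h C x y (Iall_eq_Icoord hn hxy) (Jall_eq_Jcoord hn hxy)

theorem isPolynomialIn_Jall (hn : ∀ i j, n i ⬝ᵥ n j = if i = j then 1 else 0)
    (a : Fin 6 ⊕ Fin 3) : IsPolynomialIn (Jall n) (Iall n a) := by
  have J := IsPolynomialIn.apply (Jall n)
  have t₁ : IsPolynomialIn (Jall n) (Iall n (.inr 0)) :=
    (J (.inr 0)).congr_coord hn fun C x y hI hJ => by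
      rw [hI, hJ]; rfl
  have c₁ : IsPolynomialIn (Jall n) (Iall n (.inl 0)) :=
    (J (.inl 0)).congr_coord hn fun C x y hI hJ => by
      rw [hI, hJ]; rfl
  have c₂ : IsPolynomialIn (Jall n) (Iall n (.inl 1)) :=
    (J (.inl 1)).congr_coord hn fun C x y hI hJ => by
      rw [hI, hJ]; rfl
  have t₂ : IsPolynomialIn (Jall n) (Iall n (.inr 1)) :=
    (((t₁.pow 2).sub (J (.inr 1))).smul (1 / 2)).congr_coord hn fun C x y hI hJ => by
      simp only [Pi.sub_apply, Pi.pow_apply, Pi.smul_apply, smul_eq_mul, hI, hJ]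
      simp [Icoord, Jcoord, cofDiag, sqDiag, Fin.sum_univ_three]
      ring
  have t₃ : IsPolynomialIn (Jall n) (Iall n (.inr 2)) :=
    ((((J (.inr 2)).sub (t₁.pow 3)).add ((t₁.mul t₂).smul 3)).smul (1 / 3)).congr_coord hn
      fun C x y hI hJ => by
        simp only [Pi.sub_apply, Pi.add_apply, Pi.mul_apply, Pi.pow_apply, Pi.smul_apply,
          smul_eq_mul, hI, hJ]
        simp [Icoord, Jcoord, cofDiag, detCoord, Fin.sum_univ_three]
        ring
  -- By the Cayley-Hamilton theorem `G = C² - (tr C) C + (tr G) 1`; this turns the moments of the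
  -- `gᵢ` into moments of the diagonal entries of `C²`.
  have c₄ : IsPolynomialIn (Jall n) (Iall n (.inl 3)) :=
    (((((J (.inl 3)).add ((t₁.pow 2).mul c₁)).add ((t₂.pow 2).smul 3)).sub
      ((t₁.mul (J (.inl 2))).smul 2)).add
        ((t₂.mul ((J (.inr 1)).sub (t₁.pow 2))).smul 2)).congr_coord hn
      fun C x y hI hJ => by
        simp only [Pi.sub_apply, Pi.add_apply, Pi.mul_apply, Pi.pow_apply, Pi.smul_apply,
          smul_eq_mul, hI, hJ]
        simp [Icoord, Jcoord, cofDiag, sqDiag, Fin.sum_univ_three]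
        ring
  have c₃ : IsPolynomialIn (Jall n) (Iall n (.inl 2)) :=
    (((((J (.inl 2)).sub (t₁.mul c₁)).add (t₁.mul t₂)).smul 2).add (c₁.add c₄)).congr_coord hn
      fun C x y hI hJ => by
        simp only [Pi.sub_apply, Pi.add_apply, Pi.mul_apply, Pi.smul_apply,
          smul_eq_mul, hI, hJ]
        simp [Icoord, Jcoord, cofDiag, sqDiag, Fin.sum_univ_three]
        ring
  have k : IsPolynomialIn (Jall n)
      ((1 / 2 : ℝ) • (Iall n (.inl 2) - Iall n (.inl 0) - Iall n (.inl 3))) :=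
    ((c₃.sub c₁).sub c₄).smul _
  have m : IsPolynomialIn (Jall n)
      (Jall n (.inl 4) - Iall n (.inr 0) * Iall n (.inl 1) + Iall n (.inr 1) * Iall n (.inl 0)) :=
    ((J (.inl 4)).sub (t₁.mul c₂)).add (t₂.mul c₁)
  have q : IsPolynomialIn (Jall n)
      ((1 / 6 : ℝ) • Iall n (.inr 0) ^ 4 - Iall n (.inr 0) ^ 2 * Iall n (.inl 0) +
        (4 / 3 : ℝ) • (Iall n (.inr 0) * Iall n (.inl 1)) + (1 / 2 : ℝ) • Iall n (.inl 0) ^ 2) :=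
    ((((t₁.pow 4).smul _).sub ((t₁.pow 2).mul c₁)).add ((t₁.mul c₂).smul _)).add
      ((c₁.pow 2).smul _)
  have c₅ : IsPolynomialIn (Jall n) (Iall n (.inl 4)) :=
    ((q.add (m.smul 2)).add c₄).congr_coord hn fun C x y hI hJ => by
      simp only [Pi.sub_apply, Pi.add_apply, Pi.mul_apply, Pi.pow_apply, Pi.smul_apply,
        smul_eq_mul, hI, hJ]
      simp [Icoord, Jcoord, cofDiag, sqDiag, Fin.sum_univ_three]
      ring
  -- The rational formula for the sixth general invariant, multiplied by the trace and solved
  -- for `∑ᵢ gᵢ³`.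
  have c₆ : IsPolynomialIn (Jall n) (Iall n (.inl 5)) :=
    ((t₁.mul (((((t₁.pow 2).mul c₂).sub (t₂.mul k)).add
        (((t₁.mul m).sub ((t₁.mul t₂).mul c₁)).smul 2)).add
        ((((t₃.mul c₁).smul 3).sub ((t₁.pow 2).mul t₃)).smul (1 / 2)))).add
      (((t₁.mul ((((t₁.mul (t₂.pow 2)).smul 3).add (t₁.mul c₄)).smul (1 / 4))).add
        ((((((t₂.mul c₄).smul 3).sub (t₂.pow 3)).add ((t₃.mul k).smul 3)).smul (1 / 2)).add
        ((((k.pow 2).add ((t₂.pow 2).mul c₁)).sub (((t₃.pow 2).smul 3).add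
          (c₁.mul c₄))).smul (1 / 4)))).sub
      (((t₃.mul c₂).add (t₂.mul m)).add (t₁.mul (J (.inl 5)))))).congr_coord hn
      fun C x y hI hJ => by
        simp only [Pi.sub_apply, Pi.add_apply, Pi.mul_apply, Pi.pow_apply, Pi.smul_apply,
          smul_eq_mul, hI, hJ]
        simp [Icoord, Jcoord, cofDiag, sqDiag, detCoord, Fin.sum_univ_three]
        ring
  rcases a with a | a <;> fin_cases a
  exacts [c₁, c₂, c₃, c₄, c₅, c₆, t₁, t₂, t₃]

theorem isPolynomialIn_Iall (hn : ∀ i j, n i ⬝ᵥ n j = if i = j then 1 else 0)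
    (a : Fin 6 ⊕ Fin 3) (ha : a ≠ .inl 5) : IsPolynomialIn (Iall n) (Jall n a) := by
  have I := IsPolynomialIn.apply (Iall n)
  have t₁ := I (.inr 0)
  have t₂ := I (.inr 1)
  have c₁ := I (.inl 0)
  have c₂ := I (.inl 1)
  have c₄ := I (.inl 3)
  have j₁ : IsPolynomialIn (Iall n) (Jall n (.inl 0)) :=
    c₁.congr_coord hn fun C x y hI hJ => by
      rw [hI, hJ]; rfl
  have j₂ : IsPolynomialIn (Iall n) (Jall n (.inl 1)) :=
    c₂.congr_coord hn fun C x y hI hJ => by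
      rw [hI, hJ]; rfl
  have s₁ : IsPolynomialIn (Iall n) (Jall n (.inr 0)) :=
    t₁.congr_coord hn fun C x y hI hJ => by
      rw [hI, hJ]; rfl
  have s₂ : IsPolynomialIn (Iall n) (Jall n (.inr 1)) :=
    ((t₁.pow 2).sub (t₂.smul 2)).congr_coord hn fun C x y hI hJ => by
      simp only [Pi.sub_apply, Pi.pow_apply, Pi.smul_apply, smul_eq_mul, hI, hJ]
      simp [Icoord, Jcoord, cofDiag, sqDiag, Fin.sum_univ_three]
      ring
  have s₃ : IsPolynomialIn (Iall n) (Jall n (.inr 2)) :=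
    (((t₁.pow 3).sub ((t₁.mul t₂).smul 3)).add ((I (.inr 2)).smul 3)).congr_coord hn
      fun C x y hI hJ => by
        simp only [Pi.sub_apply, Pi.add_apply, Pi.mul_apply, Pi.pow_apply, Pi.smul_apply,
          smul_eq_mul, hI, hJ]
        simp [Icoord, Jcoord, cofDiag, detCoord, Fin.sum_univ_three]
        ring
  have k : IsPolynomialIn (Iall n)
      ((1 / 2 : ℝ) • (Iall n (.inl 2) - Iall n (.inl 0) - Iall n (.inl 3))) :=
    (((I (.inl 2)).sub c₁).sub c₄).smul _
  have j₃ : IsPolynomialIn (Iall n) (Jall n (.inl 2)) :=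
    ((k.add (t₁.mul c₁)).sub (t₁.mul t₂)).congr_coord hn fun C x y hI hJ => by
      simp only [Pi.sub_apply, Pi.add_apply, Pi.mul_apply, Pi.smul_apply, smul_eq_mul, hI, hJ]
      simp [Icoord, Jcoord, cofDiag, sqDiag, Fin.sum_univ_three]
      ring
  have j₄ : IsPolynomialIn (Iall n) (Jall n (.inl 3)) :=
    ((((c₄.add ((t₁.pow 2).mul c₁)).add ((t₂.pow 2).smul 3)).add ((t₁.mul k).smul 2)).sub
      (((t₂.pow 2).smul 2).add ((t₂.mul (t₁.pow 2)).smul 2))).congr_coord hn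
      fun C x y hI hJ => by
        simp only [Pi.sub_apply, Pi.add_apply, Pi.mul_apply, Pi.pow_apply, Pi.smul_apply,
          smul_eq_mul, hI, hJ]
        simp [Icoord, Jcoord, cofDiag, sqDiag, Fin.sum_univ_three]
        ring
  -- By Newton's identity for three variables, `q` below is `∑ᵢ xᵢ⁴`.
  have q : IsPolynomialIn (Iall n)
      ((1 / 6 : ℝ) • Iall n (.inr 0) ^ 4 - Iall n (.inr 0) ^ 2 * Iall n (.inl 0) +
        (4 / 3 : ℝ) • (Iall n (.inr 0) * Iall n (.inl 1)) + (1 / 2 : ℝ) • Iall n (.inl 0) ^ 2) :=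
    ((((t₁.pow 4).smul _).sub ((t₁.pow 2).mul c₁)).add ((t₁.mul c₂).smul _)).add
      ((c₁.pow 2).smul _)
  have j₅ : IsPolynomialIn (Iall n) (Jall n (.inl 4)) :=
    ((((((I (.inl 4)).sub q).sub c₄).smul (1 / 2)).add (t₁.mul c₂)).sub
      (t₂.mul c₁)).congr_coord hn fun C x y hI hJ => by
        simp only [Pi.sub_apply, Pi.add_apply, Pi.mul_apply, Pi.pow_apply, Pi.smul_apply,
          smul_eq_mul, hI, hJ]
        simp [Icoord, Jcoord, cofDiag, sqDiag, Fin.sum_univ_three]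
        ring
  rcases a with a | a <;> fin_cases a
  exacts [j₁, j₂, j₃, j₄, j₅, absurd rfl ha, s₁, s₂, s₃]

theorem Jcub_sixth_eq_sixthRep (hn : ∀ i j, n i ⬝ᵥ n j = if i = j then 1 else 0)
    {C : Tensor2} (hC : C ∈ SymPos) :
    Jcub n 5 C =
      sixthRep (Icub n 0 C) (Icub n 1 C) (Icub n 2 C) (Icub n 3 C) (Icub n 4 C) (Icub n 5 C)
        (Iiso 0 C) (Iiso 1 C) (Iiso 2 C) := by
  obtain ⟨x, y, hxy⟩ := exists_toFrame_eq_symMat (n := n) hC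
  have hI := Iall_eq_Icoord hn hxy
  have hJ := Jall_eq_Jcoord hn hxy (.inl 5)
  have h0 : ∑ i, x i ≠ 0 := by
    have : C.trace = ∑ i, x i := hI (.inr 0)
    exact this ▸ hC.trace_pos.ne'
  change Jall n (.inl 5) C = sixthRep (Iall n (.inl 0) C) (Iall n (.inl 1) C)
    (Iall n (.inl 2) C) (Iall n (.inl 3) C) (Iall n (.inl 4) C) (Iall n (.inl 5) C)
    (Iall n (.inr 0) C) (Iall n (.inr 1) C) (Iall n (.inr 2) C)
  simp only [hI, hJ]
  exact Jcoord_sixth_eq x y h0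

end Relations

/-! ### Invariance under the cubic group -/

section Invariance

variable {n : Fin 3 → Fin 3 → ℝ}

/-- A rotation in the cubic group permutes the axes, up to sign. -/
theorem exists_perm_proj_conj (hn : ∀ i j, n i ⬝ᵥ n j = if i = j then 1 else 0) {Q : Tensor2}
    (hQ : Q ∈ groupO n) :
    ∃ e : Equiv.Perm (Fin 3), ∀ i A, proj n (e i) (Q * A * Qᵀ) = proj n i A := by
  obtain ⟨hQ1, -, hQn⟩ := hQ
  choose e he using hQn
  have hdot : ∀ i k, (Q *ᵥ n i) ⬝ᵥ (Q *ᵥ n k) = n i ⬝ᵥ n k := fun i k => by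
    rw [Matrix.dotProduct_mulVec, ← Matrix.mulVec_transpose, Matrix.mulVec_mulVec, hQ1,
      Matrix.one_mulVec]
  have hinj : Function.Injective e := by
    intro i k hik
    by_contra hne
    have h1 := hdot i k
    have h2 := hn (e k) (e k)
    rw [hn i k, if_neg hne] at h1
    rw [if_pos rfl] at h2
    rcases he i with h | h <;> rcases he k with h' | h' <;> rw [h, h', hik] at h1 <;>
      simp [h2] at h1
  refine ⟨Equiv.ofBijective e (Finite.injective_iff_bijective.mp hinj), fun i A => ?_⟩
  rw [Equiv.ofBijective_apply, proj_eq_dotProduct, proj_eq_dotProduct]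
  have key : (Q *ᵥ n i) ⬝ᵥ (Q * A * Qᵀ) *ᵥ (Q *ᵥ n i) = n i ⬝ᵥ A *ᵥ n i := by
    rw [Matrix.mulVec_mulVec, mul_assoc, hQ1, mul_one, ← Matrix.mulVec_mulVec,
      Matrix.dotProduct_mulVec, ← Matrix.mulVec_transpose, Matrix.mulVec_mulVec, hQ1,
      Matrix.one_mulVec]
  rcases he i with h | h <;> rw [h] at key <;> simpa [Matrix.mulVec_neg] using key

theorem isInvariant_Iall (hn : ∀ i j, n i ⬝ᵥ n j = if i = j then 1 else 0)
    (a : Fin 6 ⊕ Fin 3) : IsInvariant (groupO n) (Iall n a) := by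
  intro Q hQ C _
  obtain ⟨e, he⟩ := exists_perm_proj_conj hn hQ
  have hsum : ∀ φ : ℝ → ℝ → ℝ,
      ∑ i, φ (proj n i (Q * C * Qᵀ)) (proj n i (cof (Q * C * Qᵀ))) =
        ∑ i, φ (proj n i C) (proj n i (cof C)) := fun φ => by
    rw [← Equiv.sum_comp e, cof_conj hQ.1]
    simp only [he]
  rcases a with a | a <;> fin_cases a
  · exact hsum fun x _ => x ^ 2
  · exact hsum fun x _ => x ^ 3
  · exact hsum fun x g => (x + g) ^ 2
  · exact hsum fun _ g => g ^ 2
  · exact hsum fun x g => (x ^ 2 + g) ^ 2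
  · exact hsum fun _ g => g ^ 3
  · exact trace_conj hQ.1 C
  · change (cof (Q * C * Qᵀ)).trace = (cof C).trace
    rw [cof_conj hQ.1, trace_conj hQ.1]
  · exact det_conj hQ.1 C

theorem isInvariant_Jcub_sixth (hn : ∀ i j, n i ⬝ᵥ n j = if i = j then 1 else 0) :
    IsInvariant (groupO n) (Jcub n 5) := by
  intro Q hQ C _
  obtain ⟨e, he⟩ := exists_perm_proj_conj hn hQ
  have h2 : (Q * C * Qᵀ) ^ 2 = Q * C ^ 2 * Qᵀ := by rw [pow_two, pow_two, conj_mul hQ.1]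
  rw [Jcub_sixth hn, Jcub_sixth hn, h2, ← Equiv.sum_comp e]
  simp only [he]

end Invariance

section PolynomialFunctions

/-- The functions of a tensor which are polynomials in its nine entries. -/
noncomputable def polyFun : Subalgebra ℝ (Tensor2 → ℝ) :=
  Algebra.adjoin ℝ (Set.range fun (ij : Fin 3 × Fin 3) (C : Tensor2) => C ij.1 ij.2)

theorem entry_mem_polyFun (i j : Fin 3) : (fun C : Tensor2 => C i j) ∈ polyFun :=
  Algebra.subset_adjoin ⟨(i, j), rfl⟩

theorem exists_mvPolynomial_of_mem_polyFun {f : Tensor2 → ℝ} (hf : f ∈ polyFun) :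
    ∃ p : MvPolynomial (Fin 3 × Fin 3) ℝ,
      ∀ C, f C = MvPolynomial.eval (fun ij => C ij.1 ij.2) p := by
  induction hf using Algebra.adjoin_induction with
  | mem f hf =>
    obtain ⟨ij, rfl⟩ := hf
    exact ⟨MvPolynomial.X ij, fun C => by simp⟩
  | algebraMap r => exact ⟨MvPolynomial.C r, fun C => by simp⟩
  | add f g _ _ hf hg =>
    obtain ⟨p, hp⟩ := hf
    obtain ⟨q, hq⟩ := hg
    exact ⟨p + q, fun C => by simp [hp, hq]⟩
  | mul f g _ _ hf hg =>
    obtain ⟨p, hp⟩ := hf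
    obtain ⟨q, hq⟩ := hg
    exact ⟨p * q, fun C => by simp [hp, hq]⟩

theorem sum_mem_polyFun {f : Fin 3 → Tensor2 → ℝ} (hf : ∀ i, f i ∈ polyFun) :
    (fun C => ∑ i, f i C) ∈ polyFun := by
  have : (fun C => ∑ i, f i C) = ∑ i, f i := by
    ext C
    simp
  rw [this]
  exact sum_mem fun i _ => hf i

theorem det_mem_polyFun : (fun C : Tensor2 => C.det) ∈ polyFun := by
  have e := entry_mem_polyFun
  simp only [Matrix.det_fin_three]
  exact polyFun.sub_mem (polyFun.add_mem (polyFun.add_mem (polyFun.sub_mem (polyFun.sub_mem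
    (mul_mem (mul_mem (e 0 0) (e 1 1)) (e 2 2)) (mul_mem (mul_mem (e 0 0) (e 1 2)) (e 2 1)))
    (mul_mem (mul_mem (e 0 1) (e 1 0)) (e 2 2))) (mul_mem (mul_mem (e 0 1) (e 1 2)) (e 2 0)))
    (mul_mem (mul_mem (e 0 2) (e 1 0)) (e 2 1))) (mul_mem (mul_mem (e 0 2) (e 1 1)) (e 2 0))

theorem cof_entry_mem_polyFun (i j : Fin 3) : (fun C : Tensor2 => cof C i j) ∈ polyFun := by
  have h2 : ∀ i j k l i' j' k' l' : Fin 3,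
      (fun C : Tensor2 => C i j * C k l - C i' j' * C k' l') ∈ polyFun :=
    fun i j k l i' j' k' l' => polyFun.sub_mem
      (mul_mem (entry_mem_polyFun i j) (entry_mem_polyFun k l))
      (mul_mem (entry_mem_polyFun i' j') (entry_mem_polyFun k' l'))
  fin_cases i <;> fin_cases j <;>
    simp [cof, Matrix.adjugate_fin_three, neg_add_eq_sub, h2]

theorem proj_mem_polyFun (n : Fin 3 → Fin 3 → ℝ) (i : Fin 3) {A : Tensor2 → Tensor2}
    (hA : ∀ j k, (fun C => A C j k) ∈ polyFun) : (fun C => proj n i (A C)) ∈ polyFun :=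
  sum_mem_polyFun fun j => sum_mem_polyFun fun k =>
    mul_mem (polyFun.algebraMap_mem (n i j * n i k)) (hA j k)

theorem Iall_mem_polyFun (n : Fin 3 → Fin 3 → ℝ) (a : Fin 6 ⊕ Fin 3) : Iall n a ∈ polyFun := by
  have hx : ∀ i, proj n i ∈ polyFun := fun i => proj_mem_polyFun n i entry_mem_polyFun
  have hg : ∀ i, (fun C => proj n i (cof C)) ∈ polyFun := fun i =>
    proj_mem_polyFun n i cof_entry_mem_polyFun
  rcases a with a | a <;> fin_cases a
  · exact sum_mem_polyFun fun i => pow_mem (hx i) 2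
  · exact sum_mem_polyFun fun i => pow_mem (hx i) 3
  · exact sum_mem_polyFun fun i => pow_mem (add_mem (hx i) (hg i)) 2
  · exact sum_mem_polyFun fun i => pow_mem (hg i) 2
  · exact sum_mem_polyFun fun i => pow_mem (add_mem (pow_mem (hx i) 2) (hg i)) 2
  · exact sum_mem_polyFun fun i => pow_mem (hg i) 3
  · exact sum_mem_polyFun fun i => entry_mem_polyFun i i
  · exact sum_mem_polyFun fun i => cof_entry_mem_polyFun i i
  · exact det_mem_polyFun

variable {n : Fin 3 → Fin 3 → ℝ}

theorem isPolynomialInvariant_Iall (hn : ∀ i j, n i ⬝ᵥ n j = if i = j then 1 else 0)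
    (a : Fin 6 ⊕ Fin 3) : IsPolynomialInvariant (groupO n) (Iall n a) := by
  obtain ⟨p, hp⟩ := exists_mvPolynomial_of_mem_polyFun (Iall_mem_polyFun n a)
  exact ⟨isInvariant_Iall hn a, p, fun C _ => hp C⟩

theorem isPolynomialInvariant_Jcub_sixth
    (hn : ∀ i j, n i ⬝ᵥ n j = if i = j then 1 else 0) :
    IsPolynomialInvariant (groupO n) (Jcub n 5) := by
  have hsq : ∀ j k, (fun C : Tensor2 => (C ^ 2) j k) ∈ polyFun := fun j k => by
    simp only [pow_two, Matrix.mul_apply]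
    exact sum_mem_polyFun fun l => mul_mem (entry_mem_polyFun j l) (entry_mem_polyFun l k)
  have hmem : (fun C => ∑ i, proj n i C * proj n i (C ^ 2) ^ 2) ∈ polyFun :=
    sum_mem_polyFun fun i => mul_mem (proj_mem_polyFun n i entry_mem_polyFun)
      (pow_mem (proj_mem_polyFun n i hsq) 2)
  obtain ⟨p, hp⟩ := exists_mvPolynomial_of_mem_polyFun hmem
  exact ⟨isInvariant_Jcub_sixth hn, p, fun C _ => by rw [Jcub_sixth hn, ← hp]⟩

end PolynomialFunctions

/-! ### Polyconvexity -/

section Polyconvexity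

variable {n : Fin 3 → Fin 3 → ℝ}

/-- The squared length of `A n⁽ⁱ⁾`. -/
def sqLen (n : Fin 3 → Fin 3 → ℝ) (i : Fin 3) (A : Tensor2) : ℝ := ∑ j, (A *ᵥ n i) j ^ 2

theorem sqLen_nonneg (i : Fin 3) (A : Tensor2) : 0 ≤ sqLen n i A :=
  Finset.sum_nonneg fun _ _ => sq_nonneg _

theorem proj_transpose_mul_self (i : Fin 3) (A : Tensor2) :
    proj n i (Aᵀ * A) = sqLen n i A := by
  rw [proj_eq_dotProduct, ← Matrix.mulVec_mulVec, Matrix.dotProduct_mulVec,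
    Matrix.vecMul_transpose]
  simp [sqLen, dotProduct, pow_two]

theorem cof_transpose_mul_self (F : Tensor2) : cof (Fᵀ * F) = (cof F)ᵀ * cof F := by
  rw [cof_mul, cof_transpose]

theorem convexOn_finset_sum {E ι : Type*} [AddCommGroup E] [Module ℝ E] (s : Finset ι)
    {f : ι → E → ℝ} (hf : ∀ i ∈ s, ConvexOn ℝ Set.univ (f i)) :
    ConvexOn ℝ Set.univ (fun z => ∑ i ∈ s, f i z) := by
  classical
  induction s using Finset.induction_on with
  | empty => simpa using convexOn_const (0 : ℝ) convex_univ
  | insert a s ha ih =>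
    simp only [Finset.sum_insert ha]
    exact (hf a (Finset.mem_insert_self a s)).add
      (ih fun i hi => hf i (Finset.mem_insert_of_mem hi))

theorem convexOn_sqLen_comp {E : Type*} [AddCommGroup E] [Module ℝ E] (i : Fin 3)
    (φ : E →ₗ[ℝ] Tensor2) : ConvexOn ℝ Set.univ (fun z => sqLen n i (φ z)) := by
  refine convexOn_finset_sum _ fun j _ => ?_
  have hlin : IsLinearMap ℝ fun z => (φ z *ᵥ n i) j :=
    { map_add := fun a b => by simp [Matrix.add_mulVec]
      map_smul := fun c a => by simp [Matrix.smul_mulVec] }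
  exact (Even.convexOn_pow (𝕜 := ℝ) even_two).comp_linearMap (hlin.mk' _)

theorem isPolyconvex_Iall (hn : ∀ i j, n i ⬝ᵥ n j = if i = j then 1 else 0)
    (a : Fin 6 ⊕ Fin 3) : IsPolyconvex (Iall n a) := by
  let X : Fin 3 → Tensor2 × Tensor2 × ℝ → ℝ := fun i z => sqLen n i z.1
  let Y : Fin 3 → Tensor2 × Tensor2 × ℝ → ℝ := fun i z => sqLen n i z.2.1
  have hX : ∀ i, ConvexOn ℝ Set.univ (X i) := fun i =>
    convexOn_sqLen_comp i (LinearMap.fst ℝ Tensor2 (Tensor2 × ℝ))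
  have hY : ∀ i, ConvexOn ℝ Set.univ (Y i) := fun i =>
    convexOn_sqLen_comp i (LinearMap.fst ℝ Tensor2 ℝ ∘ₗ LinearMap.snd ℝ Tensor2 (Tensor2 × ℝ))
  have hX0 : ∀ i z, 0 ≤ X i z := fun i z => sqLen_nonneg i _
  have hY0 : ∀ i z, 0 ≤ Y i z := fun i z => sqLen_nonneg i _
  have hsum : ∀ {f : Fin 3 → Tensor2 × Tensor2 × ℝ → ℝ},
      (∀ i, ConvexOn ℝ Set.univ (f i)) → ConvexOn ℝ Set.univ (fun z => ∑ i, f i z) := fun hf =>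
    convexOn_finset_sum _ fun i _ => hf i
  have hx : ∀ i F, proj n i (Fᵀ * F) = X i (F, cof F, F.det) := fun i F =>
    proj_transpose_mul_self i F
  have hy : ∀ i F, proj n i (cof (Fᵀ * F)) = Y i (F, cof F, F.det) := fun i F => by
    rw [cof_transpose_mul_self]
    exact proj_transpose_mul_self i (cof F)
  rcases a with a | a <;> fin_cases a
  · exact ⟨_, hsum fun i => (hX i).pow (fun z _ => hX0 i z) 2, fun F _ => by
      simp [Iall, Icub, hx]⟩
  · exact ⟨_, hsum fun i => (hX i).pow (fun z _ => hX0 i z) 3, fun F _ => by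
      simp [Iall, Icub, hx]⟩
  · exact ⟨_, hsum fun i => ((hX i).add (hY i)).pow
      (fun z _ => add_nonneg (hX0 i z) (hY0 i z)) 2, fun F _ => by
      simp [Iall, Icub, hx, hy]⟩
  · exact ⟨_, hsum fun i => (hY i).pow (fun z _ => hY0 i z) 2, fun F _ => by
      simp [Iall, Icub, hy]⟩
  · exact ⟨_, hsum fun i => (((hX i).pow (fun z _ => hX0 i z) 2).add (hY i)).pow
      (fun z _ => add_nonneg (pow_nonneg (hX0 i z) 2) (hY0 i z)) 2, fun F _ => by
      simp [Iall, Icub, hx, hy]⟩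
  · exact ⟨_, hsum fun i => (hY i).pow (fun z _ => hY0 i z) 3, fun F _ => by
      simp [Iall, Icub, hy]⟩
  · exact ⟨_, hsum hX, fun F _ => by simp [Iall, Iiso, ← sum_proj hn, hx]⟩
  · exact ⟨_, hsum hY, fun F _ => by simp [Iall, Iiso, ← sum_proj hn, hy]⟩
  · exact ⟨_, (Even.convexOn_pow (𝕜 := ℝ) even_two).comp_linearMap
      (LinearMap.snd ℝ Tensor2 ℝ ∘ₗ LinearMap.snd ℝ Tensor2 (Tensor2 × ℝ)), fun F _ => by
      simp [Iall, Iiso, pow_two]⟩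

end Polyconvexity

/-! ### The sixth general invariant is not a polynomial in the nine functions -/

section NotPolynomial

/-- The symmetric tensors whose diagonal entries exceed `2` and whose off-diagonal entries are
less than `1` in modulus are positive definite. -/
theorem posDef_symMat {x y : Fin 3 → ℝ} (hx : ∀ i, 2 < x i) (hy : ∀ i, |y i| < 1) :
    (symMat x y).PosDef := by
  rw [Matrix.posDef_iff_dotProduct_mulVec]
  refine ⟨?_, fun v hv => ?_⟩
  · rw [Matrix.IsHermitian, Matrix.conjTranspose_eq_transpose_of_trivial, transpose_symMat]
  have hpair : ∀ i a b, 0 ≤ a ^ 2 + b ^ 2 + 2 * y i * a * b := fun i a b => by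
    have h := abs_lt.mp (hy i)
    nlinarith [mul_nonneg (by linarith : (0 : ℝ) ≤ 1 + y i) (sq_nonneg (a + b)),
      mul_nonneg (by linarith : (0 : ℝ) ≤ 1 - y i) (sq_nonneg (a - b))]
  have hpos : 0 < ∑ i, (x i - 2) * v i ^ 2 := by
    obtain ⟨i, hi⟩ := Function.ne_iff.mp hv
    refine Finset.sum_pos' (fun j _ => mul_nonneg (by linarith [hx j]) (sq_nonneg _))
      ⟨i, Finset.mem_univ i, mul_pos (by linarith [hx i]) (sq_pos_of_ne_zero hi)⟩
  have h0 := hpair 0 (v 1) (v 2)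
  have h1 := hpair 1 (v 2) (v 0)
  have h2 := hpair 2 (v 0) (v 1)
  simp only [Fin.sum_univ_three] at hpos
  simp [symMat, dotProduct, Matrix.mulVec, Fin.sum_univ_three]
  linarith

theorem toFrame_conj_transpose {n : Fin 3 → Fin 3 → ℝ}
    (hn : ∀ i j, n i ⬝ᵥ n j = if i = j then 1 else 0) (A : Tensor2) :
    toFrame n ((Matrix.of n)ᵀ * A * Matrix.of n) = A := by
  rw [toFrame, mul_assoc, mul_assoc, of_mul_transpose hn, mul_one, ← mul_assoc,
    of_mul_transpose hn, one_mul]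

theorem mem_SymPos_conj_transpose {n : Fin 3 → Fin 3 → ℝ}
    (hn : ∀ i j, n i ⬝ᵥ n j = if i = j then 1 else 0) {A : Tensor2} (hA : A.PosDef) :
    (Matrix.of n)ᵀ * A * Matrix.of n ∈ SymPos := by
  have hinj : Function.Injective (Matrix.of n).mulVec := fun u v huv => by
    simpa [Matrix.mulVec_mulVec, transpose_mul_of hn] using congrArg ((Matrix.of n)ᵀ *ᵥ ·) huv
  have := hA.conjTranspose_mul_mul_same hinj
  rwa [Matrix.conjTranspose_eq_transpose_of_trivial] at this

theorem map_aeval_Icoord {A B : Type*} [CommRing A] [Algebra ℝ A] [CommRing B] [Algebra ℝ B]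
    (f : A →ₐ[ℝ] B) (p : MvPolynomial (Fin 6 ⊕ Fin 3) ℝ) (x y : Fin 3 → A) :
    f (MvPolynomial.aeval (Icoord x y) p) =
      MvPolynomial.aeval (Icoord (fun i => f (x i)) fun i => f (y i)) p := by
  rw [show (Icoord (fun i => f (x i)) fun i => f (y i)) = fun a => f (Icoord x y a) from
    funext fun a => (map_Icoord (f : A →+* B) x y a).symm]
  exact MvPolynomial.comp_aeval_apply (f := Icoord x y) f p

/-- A polynomial relation between the invariants on the positive definite tensors is an identity
of polynomials, hence holds at symmetric matrices over every commutative `ℝ`-algebra. -/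
theorem aeval_Icoord_eq_of_isPolynomialIn {n : Fin 3 → Fin 3 → ℝ}
    (hn : ∀ i j, n i ⬝ᵥ n j = if i = j then 1 else 0) {p : MvPolynomial (Fin 6 ⊕ Fin 3) ℝ}
    (hp : ∀ C ∈ SymPos, Jcub n 5 C = MvPolynomial.eval (fun a => Iall n a C) p)
    {A : Type*} [CommRing A] [Algebra ℝ A] (x y : Fin 3 → A) :
    MvPolynomial.aeval (Icoord x y) p = Jcoord x y (.inl 5) := by
  let xg : Fin 3 → MvPolynomial (Fin 3 ⊕ Fin 3) ℝ := fun i => MvPolynomial.X (.inl i)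
  let yg : Fin 3 → MvPolynomial (Fin 3 ⊕ Fin 3) ℝ := fun i => MvPolynomial.X (.inr i)
  have hgen : MvPolynomial.aeval (Icoord xg yg) p = Jcoord xg yg (.inl 5) := by
    let s : Fin 3 ⊕ Fin 3 → Set ℝ := Sum.elim (fun _ => Set.Ioo 2 3) (fun _ => Set.Ioo (-1) 1)
    refine MvPolynomial.funext_set s ?_ fun v hv => ?_
    · rintro (i | i)
      · exact Set.Ioo_infinite (by norm_num)
      · exact Set.Ioo_infinite (by norm_num)
    have hpos : (symMat (fun i => v (.inl i)) fun i => v (.inr i)).PosDef :=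
      posDef_symMat (fun i => (hv (.inl i) trivial).1)
        fun i => abs_lt.mpr (hv (.inr i) trivial)
    have hF := toFrame_conj_transpose hn (symMat (fun i => v (.inl i)) fun i => v (.inr i))
    have h := hp _ (mem_SymPos_conj_transpose hn hpos)
    have hJ := Jall_eq_Jcoord hn hF (.inl 5)
    simp only [Iall_eq_Icoord hn hF] at h
    rw [show Jcub n 5 _ = _ from hJ] at h
    rw [map_Jcoord_sixth, ← MvPolynomial.coe_aeval_eq_eval, RingHom.coe_coe,
      map_aeval_Icoord]
    simpa only [xg, yg, MvPolynomial.aeval_X, MvPolynomial.aeval_eq_eval] using h.symm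
  have h := congrArg (MvPolynomial.aeval (Sum.elim x y)) hgen
  have hJ := map_Jcoord_sixth (MvPolynomial.aeval (Sum.elim x y) : _ →ₐ[ℝ] A).toRingHom xg yg
  rw [map_aeval_Icoord] at h
  refine Eq.trans ?_ (h.trans (hJ.trans ?_)) <;> simp [xg, yg]

/-- The numerical semigroup generated by `3` and `4` has the gaps `1`, `2`, `5`: univariate
polynomials without terms of these degrees form a subalgebra. -/
theorem coeff_aeval_eq_zero {A ι : Type*} [CommRing A] [Algebra ℝ A]
    {v : ι → Polynomial A}
    (hv : ∀ i, (v i).coeff 1 = 0 ∧ (v i).coeff 2 = 0 ∧ (v i).coeff 5 = 0)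
    (p : MvPolynomial ι ℝ) :
    (MvPolynomial.aeval v p).coeff 1 = 0 ∧ (MvPolynomial.aeval v p).coeff 2 = 0 ∧
      (MvPolynomial.aeval v p).coeff 5 = 0 := by
  induction p using MvPolynomial.induction_on with
  | C r => simp [Polynomial.algebraMap_apply]
  | add p q hp hq => simp [hp, hq]
  | mul_X p i hp =>
    obtain ⟨h1, h2, h5⟩ := hv i
    obtain ⟨k1, k2, k5⟩ := hp
    simp [Polynomial.coeff_mul, Finset.Nat.antidiagonal_succ, h1, h2, h5, k1, k2, k5]

/-- The nine invariants on a line of symmetric matrices, built from a third root of unity `w`, on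
which the trace and the quadratic invariants vanish. -/
theorem Icoord_rootOfUnity {R : Type*} [CommRing R] {w : R} (hw : w ^ 2 + w + 1 = 0) (s : R) :
    Icoord ![s, w * s, w ^ 2 * s] ![s, w ^ 2 * s, w * s] = Sum.elim
      ![0, 3 * s ^ 3, 6 * s ^ 3 - 6 * s ^ 4, -6 * s ^ 4, -12 * s ^ 4, 0] ![0, 0, 3 * s ^ 3] := by
  funext a
  rcases a with a | a <;> fin_cases a <;>
    simp [Icoord, cofDiag, detCoord, Fin.sum_univ_three] <;> grind

theorem Jcoord_sixth_rootOfUnity {R : Type*} [CommRing R] {w : R} (hw : w ^ 2 + w + 1 = 0)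
    (s : R) :
    Jcoord ![s, w * s, w ^ 2 * s] ![s, w ^ 2 * s, w * s] (.inl 5) = 3 * s ^ 5 := by
  simp [Jcoord, sqDiag, Fin.sum_univ_three]
  grind

theorem not_isPolynomialIn_Jcub_sixth {n : Fin 3 → Fin 3 → ℝ}
    (hn : ∀ i j, n i ⬝ᵥ n j = if i = j then 1 else 0) :
    ¬ IsPolynomialIn (Iall n) (Jcub n 5) := by
  rintro ⟨p, hp⟩
  -- A primitive third root of unity.
  obtain ⟨w, hw⟩ : ∃ w : ℂ, w ^ 2 + w + 1 = 0 := by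
    obtain ⟨z, hz⟩ := IsAlgClosed.exists_pow_nat_eq (-3 : ℂ) two_pos
    exact ⟨(z - 1) / 2, by linear_combination hz / 4⟩
  have hW : (Polynomial.C w) ^ 2 + Polynomial.C w + 1 = 0 := by
    simp only [← Polynomial.C_pow, ← Polynomial.C_add, ← Polynomial.C_1, hw, map_zero]
  have h := aeval_Icoord_eq_of_isPolynomialIn hn hp
    ![Polynomial.X, Polynomial.C w * Polynomial.X, Polynomial.C w ^ 2 * Polynomial.X]
    ![Polynomial.X, Polynomial.C w ^ 2 * Polynomial.X, Polynomial.C w * Polynomial.X]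
  rw [Icoord_rootOfUnity hW, Jcoord_sixth_rootOfUnity hW] at h
  have h5 := (coeff_aeval_eq_zero (A := ℂ) (v := Sum.elim
      ![0, 3 * Polynomial.X ^ 3, 6 * Polynomial.X ^ 3 - 6 * Polynomial.X ^ 4,
        -6 * Polynomial.X ^ 4, -12 * Polynomial.X ^ 4, 0]
      ![0, 0, 3 * Polynomial.X ^ 3]) (fun a => by
    rcases a with a | a <;> fin_cases a <;>
      simp [Polynomial.coeff_X_pow, Polynomial.coeff_ofNat_mul]) p).2.2
  rw [h] at h5
  simp [Polynomial.coeff_ofNat_mul] at h5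

end NotPolynomial

/-! ### The nine functions separate the orbits -/

section Separation

/-- Three numbers are determined, up to their order, by their first three power sums. -/
theorem exists_perm_of_powerSums {u v : Fin 3 → ℝ} (h1 : ∑ i, v i = ∑ i, u i)
    (h2 : ∑ i, v i ^ 2 = ∑ i, u i ^ 2) (h3 : ∑ i, v i ^ 3 = ∑ i, u i ^ 3) :
    ∃ σ : Equiv.Perm (Fin 3), ∀ i, v i = u (σ i) := by
  -- By Newton's identities `v 0` is a root of the cubic with the roots `u i`.
  obtain ⟨j, hj⟩ : ∃ j, v 0 = u j := by
    simp only [Fin.sum_univ_three] at h1 h2 h3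
    have e2 : v 0 * v 1 + v 0 * v 2 + v 1 * v 2 = u 0 * u 1 + u 0 * u 2 + u 1 * u 2 := by
      linear_combination (v 0 + v 1 + v 2 + u 0 + u 1 + u 2) / 2 * h1 - h2 / 2
    have e3 : v 0 * v 1 * v 2 = u 0 * u 1 * u 2 := by
      linear_combination h3 / 3 - (v 0 ^ 2 + v 1 ^ 2 + v 2 ^ 2) / 3 * h1 -
        (u 0 + u 1 + u 2) / 3 * h2 + (v 0 * v 1 + v 0 * v 2 + v 1 * v 2) / 3 * h1 +
        (u 0 + u 1 + u 2) / 3 * e2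
    have hroot : (v 0 - u 0) * (v 0 - u 1) * (v 0 - u 2) = 0 := by
      linear_combination v 0 ^ 2 * h1 - v 0 * e2 + e3
    rcases mul_eq_zero.mp hroot with h | h
    · rcases mul_eq_zero.mp h with h | h
      · exact ⟨0, sub_eq_zero.mp h⟩
      · exact ⟨1, sub_eq_zero.mp h⟩
    · exact ⟨2, sub_eq_zero.mp h⟩
  let τ : Equiv.Perm (Fin 3) := Equiv.swap 0 j
  have hτ0 : v 0 = u (τ 0) := by rw [hj, Equiv.swap_apply_left]
  rw [← Equiv.sum_comp τ u] at h1
  rw [← Equiv.sum_comp τ fun i => u i ^ 2] at h2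
  simp only [Fin.sum_univ_three] at h1 h2
  have hpair : (v 1 - u (τ 1)) * (v 1 - u (τ 2)) = 0 := by
    linear_combination (v 1 - v 2 - u (τ 1) - u (τ 2)) / 2 * (h1 - hτ0) +
      (h2 - (v 0 + u (τ 0)) * hτ0) / 2
  rcases mul_eq_zero.mp hpair with h | h
  · refine ⟨τ, fun i => ?_⟩
    fin_cases i
    · exact hτ0
    · exact sub_eq_zero.mp h
    · change v 2 = u (τ 2)
      linear_combination h1 - hτ0 - h
  · refine ⟨τ * Equiv.swap 1 2, fun i => ?_⟩
    fin_cases i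
    · exact hτ0
    · exact sub_eq_zero.mp h
    · change v 2 = u (τ 1)
      linear_combination h1 - hτ0 - h

/-- Three points of the plane are determined, up to their order, by their joint moments up to
degree three: each projection `x + l g` is determined up to a permutation, and two different
slopes `l` must share their permutation. -/
theorem exists_perm_of_moments {x g x' g' : Fin 3 → ℝ}
    (h1 : ∀ l : ℝ, ∑ i, (x' i + l * g' i) = ∑ i, (x i + l * g i))
    (h2 : ∀ l : ℝ, ∑ i, (x' i + l * g' i) ^ 2 = ∑ i, (x i + l * g i) ^ 2)
    (h3 : ∀ l : ℝ, ∑ i, (x' i + l * g' i) ^ 3 = ∑ i, (x i + l * g i) ^ 3) :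
    ∃ σ : Equiv.Perm (Fin 3), (∀ i, x' i = x (σ i)) ∧ ∀ i, g' i = g (σ i) := by
  choose σ hσ using fun k : ℕ => exists_perm_of_powerSums (h1 k) (h2 k) (h3 k)
  obtain ⟨k, l, hkl, hs⟩ := Finite.exists_ne_map_eq_of_infinite σ
  have hne : (k : ℝ) - l ≠ 0 := sub_ne_zero.mpr (Nat.cast_injective.ne hkl)
  have hg : ∀ i, g' i = g (σ k i) := fun i => by
    have hk := hσ k i
    have hl := hσ l i
    rw [← hs] at hl
    exact mul_left_cancel₀ hne (by linear_combination hk - hl)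
  exact ⟨σ k, fun i => by linear_combination hσ k i - (k : ℝ) * hg i, hg⟩

theorem perm_add_one_add_two (σ : Equiv.Perm (Fin 3)) (i : Fin 3) :
    (σ (i + 1) = σ i + 1 ∧ σ (i + 2) = σ i + 2) ∨
      (σ (i + 1) = σ i + 2 ∧ σ (i + 2) = σ i + 1) := by
  revert σ i
  decide

variable {x y x' y' : Fin 3 → ℝ}

/-- The nine invariants determine the diagonal up to a permutation, and then the squares and the
product of the off-diagonal entries. -/
theorem exists_perm_of_Icoord_eq (h0 : ∑ i, x i ≠ 0)
    (h : ∀ a, Icoord x' y' a = Icoord x y a) :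
    ∃ σ : Equiv.Perm (Fin 3), (∀ i, x' i = x (σ i)) ∧ (∀ i, y' i ^ 2 = y (σ i) ^ 2) ∧
      ∏ i, y' i = ∏ i, y (σ i) := by
  have t1 : ∑ i, x' i = ∑ i, x i := h (.inr 0)
  have h6 : Jcoord x' y' (.inl 5) = Jcoord x y (.inl 5) := by
    rw [Jcoord_sixth_eq x' y' (t1 ▸ h0), Jcoord_sixth_eq x y h0]
    simp only [h]
  have t2 : ∑ i, cofDiag x' y' i = ∑ i, cofDiag x y i := h (.inr 1)
  have t3 : detCoord x' y' = detCoord x y := h (.inr 2)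
  have c1 : ∑ i, x' i ^ 2 = ∑ i, x i ^ 2 := h (.inl 0)
  have c2 : ∑ i, x' i ^ 3 = ∑ i, x i ^ 3 := h (.inl 1)
  have c3 : ∑ i, (x' i + cofDiag x' y' i) ^ 2 = ∑ i, (x i + cofDiag x y i) ^ 2 := h (.inl 2)
  have c4 : ∑ i, cofDiag x' y' i ^ 2 = ∑ i, cofDiag x y i ^ 2 := h (.inl 3)
  have c5 : ∑ i, (x' i ^ 2 + cofDiag x' y' i) ^ 2 = ∑ i, (x i ^ 2 + cofDiag x y i) ^ 2 :=
    h (.inl 4)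
  have c6 : ∑ i, cofDiag x' y' i ^ 3 = ∑ i, cofDiag x y i ^ 3 := h (.inl 5)
  -- The Cayley-Hamilton theorem, on the diagonal.
  have hw : ∀ u v : Fin 3 → ℝ, ∀ i, sqDiag u v i =
      cofDiag u v i + (∑ j, u j) * u i - ∑ j, cofDiag u v j := by
    intro u v i
    fin_cases i <;> simp [sqDiag, cofDiag, Fin.sum_univ_three] <;> ring
  have hxg : ∑ i, x' i * cofDiag x' y' i = ∑ i, x i * cofDiag x y i := by
    simp only [Fin.sum_univ_three] at c1 c3 c4 ⊢
    linear_combination (c3 - c1 - c4) / 2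
  have hxxg : ∑ i, x' i ^ 2 * cofDiag x' y' i = ∑ i, x i ^ 2 * cofDiag x y i := by
    obtain ⟨τ, hτ⟩ := exists_perm_of_powerSums t1 c1 c2
    have q : ∑ i, x' i ^ 4 = ∑ i, x i ^ 4 := by
      rw [← Equiv.sum_comp τ fun i => x i ^ 4]
      simp only [hτ]
    simp only [Fin.sum_univ_three] at c4 c5 q ⊢
    linear_combination (c5 - q - c4) / 2
  -- The sixth general invariant supplies the one joint moment of degree at most three which is
  -- not a polynomial in the nine functions.
  have hxgg : ∑ i, x' i * cofDiag x' y' i ^ 2 = ∑ i, x i * cofDiag x y i ^ 2 := by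
    have expand : ∀ (u g : Fin 3 → ℝ) (a b : ℝ), ∑ i, u i * (g i + a * u i - b) ^ 2 =
        (∑ i, u i * g i ^ 2) + a ^ 2 * (∑ i, u i ^ 3) + b ^ 2 * (∑ i, u i) +
          2 * a * (∑ i, u i ^ 2 * g i) - 2 * b * (∑ i, u i * g i) -
          2 * a * b * ∑ i, u i ^ 2 := fun u g a b => by
      simp only [Fin.sum_univ_three]
      ring
    change ∑ i, x' i * sqDiag x' y' i ^ 2 = ∑ i, x i * sqDiag x y i ^ 2 at h6
    simp only [hw, expand, t1, t2, c1, c2, hxg, hxxg] at h6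
    linear_combination h6
  obtain ⟨σ, hx, hg⟩ := exists_perm_of_moments (x := x) (g := cofDiag x y) (x' := x')
    (g' := cofDiag x' y')
    (fun l => by
      simp only [Fin.sum_univ_three] at t1 t2 ⊢
      linear_combination t1 + l * t2)
    (fun l => by
      simp only [Fin.sum_univ_three] at c1 hxg c4 ⊢
      linear_combination c1 + 2 * l * hxg + l ^ 2 * c4)
    (fun l => by
      simp only [Fin.sum_univ_three] at c2 hxxg hxgg c6 ⊢
      linear_combination c2 + 3 * l * hxxg + 3 * l ^ 2 * hxgg + l ^ 3 * c6)
  have hy : ∀ i, y' i ^ 2 = y (σ i) ^ 2 := fun i => by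
    have hgi := hg i
    rw [cofDiag, cofDiag, hx, hx] at hgi
    rcases perm_add_one_add_two σ i with ⟨e1, e2⟩ | ⟨e1, e2⟩ <;> rw [e1, e2] at hgi <;>
      linear_combination -hgi
  refine ⟨σ, hx, hy, ?_⟩
  have hxy : ∑ i, x' i * y' i ^ 2 = ∑ i, x i * y i ^ 2 := by
    rw [← Equiv.sum_comp σ fun i => x i * y i ^ 2]
    simp only [hx, hy]
  have hxp : ∏ i, x' i = ∏ i, x i := by
    rw [← Equiv.prod_comp σ x]
    simp only [hx]
  rw [detCoord, detCoord, hxy] at t3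
  rw [Equiv.prod_comp σ y]
  simp only [Fin.prod_univ_three] at hxp ⊢
  linear_combination t3 / 2 - hxp / 2

/-- If two triples agree up to signs and have the same product, then the signs can be chosen with
product one: if their product is not one, some entry vanishes and its sign is free. -/
theorem exists_signs {u v : Fin 3 → ℝ} (h2 : ∀ i, v i ^ 2 = u i ^ 2)
    (hp : ∏ i, v i = ∏ i, u i) :
    ∃ ε : Fin 3 → ℝ, (∀ i, ε i ^ 2 = 1) ∧ (∀ i, v i = ε i * u i) ∧ ∏ i, ε i = 1 := by
  have hex : ∀ i, ∃ e : ℝ, e ^ 2 = 1 ∧ v i = e * u i := fun i => by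
    rcases sq_eq_sq_iff_eq_or_eq_neg.mp (h2 i) with h | h
    · exact ⟨1, by norm_num, by rw [h, one_mul]⟩
    · exact ⟨-1, by norm_num, by rw [h, neg_one_mul]⟩
  choose ε hε hv using hex
  have hsq : (∏ i, ε i) ^ 2 = 1 := by rw [← Finset.prod_pow]; simp [hε]
  rcases sq_eq_one_iff.mp hsq with h | h
  · exact ⟨ε, hε, hv, h⟩
  have hz : ∏ i, u i = 0 := by
    have : ∏ i, v i = (∏ i, ε i) * ∏ i, u i := by
      rw [← Finset.prod_mul_distrib]
      exact Finset.prod_congr rfl fun i _ => hv i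
    rw [h, hp] at this
    linarith
  obtain ⟨k, -, hk⟩ := Finset.prod_eq_zero_iff.mp hz
  refine ⟨Function.update ε k (-ε k), fun i => ?_, fun i => ?_, ?_⟩
  · by_cases hik : i = k
    · subst hik; simp [hε]
    · simp [hik, hε]
  · by_cases hik : i = k
    · subst hik; simp [hv, hk]
    · simp [hik, hv]
  · rw [Finset.prod_update_of_mem (Finset.mem_univ k), neg_mul,
      ← Finset.prod_eq_mul_prod_sdiff_singleton_of_mem (Finset.mem_univ k), h,
      neg_neg]

/-- The signed permutation matrix which sends the basis vector `σ i` to `d i` times the basis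
vector `i`. -/
def signedPerm (σ : Equiv.Perm (Fin 3)) (d : Fin 3 → ℝ) : Tensor2 :=
  Matrix.diagonal d * σ.permMatrix ℝ

theorem signedPerm_mulVec_single (σ : Equiv.Perm (Fin 3)) (d : Fin 3 → ℝ) (i : Fin 3) :
    signedPerm σ d *ᵥ Pi.single (σ i) 1 = d i • Pi.single i 1 := by
  ext j
  simp [signedPerm, Matrix.diagonal_mul, PEquiv.toMatrix_apply, Pi.single_apply]
  grind

theorem signedPerm_conj_apply (σ : Equiv.Perm (Fin 3)) (d : Fin 3 → ℝ) (A : Tensor2)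
    (i j : Fin 3) :
    (signedPerm σ d * A * (signedPerm σ d)ᵀ) i j = d i * d j * A (σ i) (σ j) := by
  rw [signedPerm, Matrix.transpose_mul, Matrix.diagonal_transpose, Matrix.transpose_permMatrix,
    mul_assoc, mul_assoc, ← mul_assoc A, ← mul_assoc (σ.permMatrix ℝ), ← mul_assoc,
    Matrix.mul_diagonal, Matrix.diagonal_mul, ← mul_assoc, PEquiv.toMatrix_toPEquiv_mul,
    PEquiv.mul_toMatrix_toPEquiv]
  simp only [Matrix.submatrix_apply, id]
  rw [← Equiv.Perm.inv_def, inv_inv]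
  ring

theorem transpose_mul_signedPerm (σ : Equiv.Perm (Fin 3)) {d : Fin 3 → ℝ}
    (hd : ∀ i, d i ^ 2 = 1) : (signedPerm σ d)ᵀ * signedPerm σ d = 1 := by
  rw [mul_eq_one_comm]
  ext i j
  have h := signedPerm_conj_apply σ d 1 i j
  rw [mul_one] at h
  rw [h, Matrix.one_apply, Matrix.one_apply]
  by_cases hij : i = j
  · simp [hij, ← pow_two, hd]
  · simp [hij]

theorem det_signedPerm (σ : Equiv.Perm (Fin 3)) (d : Fin 3 → ℝ) :
    (signedPerm σ d).det = (∏ i, d i) * (Equiv.Perm.sign σ : ℤ) := by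
  simp [signedPerm, Matrix.det_permutation]

/-- The total sign of a signed permutation does not affect the conjugation, so that it can always
be taken to be a rotation. -/
theorem exists_rotation_of_Icoord_eq (h0 : ∑ i, x i ≠ 0)
    (h : ∀ a, Icoord x' y' a = Icoord x y a) :
    ∃ (σ : Equiv.Perm (Fin 3)) (d : Fin 3 → ℝ), (∀ i, d i ^ 2 = 1) ∧
      (signedPerm σ d).det = 1 ∧
      signedPerm σ d * symMat x y * (signedPerm σ d)ᵀ = symMat x' y' := by
  obtain ⟨σ, hx, hy, hp⟩ := exists_perm_of_Icoord_eq h0 h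
  obtain ⟨ε, hε, hv, hprod⟩ := exists_signs hy hp
  obtain ⟨s, hs, hdet⟩ : ∃ s : ℝ, s ^ 2 = 1 ∧ s * (Equiv.Perm.sign σ : ℤ) = 1 := by
    rcases Int.units_eq_one_or (Equiv.Perm.sign σ) with h | h
    · exact ⟨1, by simp, by simp [h]⟩
    · exact ⟨-1, by simp, by simp [h]⟩
  refine ⟨σ, fun i => s * ε i, fun i => by rw [mul_pow, hs, hε, one_mul], ?_, ?_⟩
  · rw [det_signedPerm, Finset.prod_mul_distrib, hprod]
    simp only [Finset.prod_const, Finset.card_univ, Fintype.card_fin]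
    linear_combination hdet + s * (Equiv.Perm.sign σ : ℤ) * hs
  have hsym : (signedPerm σ (fun i => s * ε i) * symMat x y *
      (signedPerm σ (fun i => s * ε i))ᵀ)ᵀ =
        signedPerm σ (fun i => s * ε i) * symMat x y * (signedPerm σ (fun i => s * ε i))ᵀ := by
    simp [Matrix.transpose_mul, transpose_symMat, mul_assoc]
  rw [eq_symMat hsym]
  congr 1
  · funext i
    rw [signedPerm_conj_apply, symMat_diag, hx]
    linear_combination x (σ i) * (s ^ 2 * hε i + hs)
  · funext i
    have hsw : symMat x y (σ (i + 1)) (σ (i + 2)) = y (σ i) := by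
      rcases perm_add_one_add_two σ i with ⟨e1, e2⟩ | ⟨e1, e2⟩ <;> rw [e1, e2]
      · exact symMat_offDiag x y (σ i)
      · rw [← Matrix.transpose_apply (symMat x y), transpose_symMat]
        exact symMat_offDiag x y (σ i)
    -- Signs with product one satisfy `ε (i + 1) * ε (i + 2) = ε i`.
    have hεε : ε (i + 1) * ε (i + 2) = ε i := by
      have hi : ε i * (ε (i + 1) * ε (i + 2)) = 1 := by
        rw [← hprod, Fin.prod_univ_three]
        fin_cases i <;> simp <;> ring
      linear_combination ε i * hi - ε (i + 1) * ε (i + 2) * hε i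
    rw [signedPerm_conj_apply, hsw, hv]
    linear_combination y (σ i) * (s ^ 2 * hεε + ε i * hs)

variable {n : Fin 3 → Fin 3 → ℝ}

theorem conj_signedPerm_mem_groupO (hn : ∀ i j, n i ⬝ᵥ n j = if i = j then 1 else 0)
    {σ : Equiv.Perm (Fin 3)} {d : Fin 3 → ℝ} (hd : ∀ i, d i ^ 2 = 1)
    (hdet : (signedPerm σ d).det = 1) :
    (Matrix.of n)ᵀ * signedPerm σ d * Matrix.of n ∈ groupO n := by
  have h1 := of_mul_transpose hn
  have h2 := transpose_mul_of hn
  refine ⟨?_, ?_, fun i => ?_⟩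
  · calc _ = (Matrix.of n)ᵀ * ((signedPerm σ d)ᵀ * (Matrix.of n * (Matrix.of n)ᵀ) *
          signedPerm σ d) * Matrix.of n := by
          simp only [Matrix.transpose_mul, Matrix.transpose_transpose, mul_assoc]
      _ = 1 := by rw [h1, mul_one, transpose_mul_signedPerm σ hd, mul_one, h2]
  · have := congrArg Matrix.det h2
    rw [Matrix.det_mul, Matrix.det_one] at this
    rw [Matrix.det_mul, Matrix.det_mul, hdet, mul_one, this]
  · have e1 : Matrix.of n *ᵥ n i = Pi.single i 1 := by
      ext j
      rw [Pi.single_apply, ← hn j i]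
      rfl
    have e2 : ∀ j, (Matrix.of n)ᵀ *ᵥ Pi.single j 1 = n j := fun j => by
      ext k
      simp
    refine ⟨σ.symm i, ?_⟩
    have hact := signedPerm_mulVec_single σ d (σ.symm i)
    rw [Equiv.apply_symm_apply] at hact
    rw [← Matrix.mulVec_mulVec, e1, ← Matrix.mulVec_mulVec, hact, Matrix.mulVec_smul, e2]
    rcases sq_eq_one_iff.mp (hd (σ.symm i)) with h | h <;> simp [h]

/-- The nine functions separate the orbits of the cubic group. -/
theorem exists_mem_groupO_of_Iall_eq (hn : ∀ i j, n i ⬝ᵥ n j = if i = j then 1 else 0)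
    {C C' : Tensor2} (hC : C ∈ SymPos) (hC' : C' ∈ SymPos)
    (h : ∀ a, Iall n a C' = Iall n a C) : ∃ Q ∈ groupO n, Q * C * Qᵀ = C' := by
  obtain ⟨x, y, hxy⟩ := exists_toFrame_eq_symMat (n := n) hC
  obtain ⟨x', y', hxy'⟩ := exists_toFrame_eq_symMat (n := n) hC'
  have h0 : ∑ i, x i ≠ 0 := by
    have : C.trace = ∑ i, x i := Iall_eq_Icoord hn hxy (.inr 0)
    exact this ▸ hC.trace_pos.ne'
  obtain ⟨σ, d, hd, hdet, hconj⟩ := exists_rotation_of_Icoord_eq (x' := x') (y' := y') h0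
    fun a => by rw [← Iall_eq_Icoord hn hxy, ← Iall_eq_Icoord hn hxy', h]
  refine ⟨_, conj_signedPerm_mem_groupO hn hd hdet, ?_⟩
  rw [← hxy, ← hxy', toFrame, toFrame] at hconj
  have h2 := transpose_mul_of hn
  calc _ = (Matrix.of n)ᵀ * (signedPerm σ d * (Matrix.of n * C * (Matrix.of n)ᵀ) *
        (signedPerm σ d)ᵀ) * Matrix.of n := by
        simp only [Matrix.transpose_mul, Matrix.transpose_transpose, mul_assoc]
    _ = ((Matrix.of n)ᵀ * Matrix.of n) * C' * ((Matrix.of n)ᵀ * Matrix.of n) := by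
        rw [hconj]
        simp only [mul_assoc]
    _ = C' := by rw [h2, one_mul, mul_one]

theorem isFunctionalBasis_Iall (hn : ∀ i j, n i ⬝ᵥ n j = if i = j then 1 else 0) :
    IsFunctionalBasis (groupO n) (Iall n) := by
  classical
  refine ⟨isInvariant_Iall hn, fun f hf => ?_⟩
  let ψ : (Fin 6 ⊕ Fin 3 → ℝ) → ℝ := fun v =>
    if hv : ∃ C ∈ SymPos, (fun a => Iall n a C) = v then f hv.choose else 0
  refine ⟨ψ, fun C hC => ?_⟩
  have hv : ∃ D ∈ SymPos, (fun a => Iall n a D) = fun a => Iall n a C := ⟨C, hC, rfl⟩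
  obtain ⟨hD, hDC⟩ := hv.choose_spec
  obtain ⟨Q, hQ, hQC⟩ := exists_mem_groupO_of_Iall_eq hn hC hD (congrFun hDC)
  have hψ : ψ (fun a => Iall n a C) = f hv.choose := dif_pos hv
  rw [hψ, ← hQC, hf Q hQ C hC]

end Separation

end Cubic

theorem mainTheorem4 (n : Fin 3 → Fin 3 → ℝ)
    (hn : ∀ i j, n i ⬝ᵥ n j = if i = j then 1 else 0) :
    -- all nine functions are polyconvex and are (polynomial) invariants of the cubic group
    (∀ a, Cubic.IsPolyconvex (Cubic.Iall n a)) ∧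
    (∀ a, Cubic.IsPolynomialInvariant (Cubic.groupO n) (Cubic.Iall n a)) ∧
    -- they are polynomials in the general invariants
    (∀ a, Cubic.IsPolynomialIn (Cubic.Jall n) (Cubic.Iall n a)) ∧
    -- the general invariants other than the sixth cubic one are polynomials in them
    (∀ a, a ≠ Sum.inl 5 → Cubic.IsPolynomialIn (Cubic.Iall n) (Cubic.Jall n a)) ∧
    -- the sixth one is obtained with a division by the trace, which is positive,
    (∀ C ∈ Cubic.SymPos, 0 < C.trace ∧
      Cubic.Jcub n 5 C =
        Cubic.sixthRep (Cubic.Icub n 0 C) (Cubic.Icub n 1 C) (Cubic.Icub n 2 C)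
          (Cubic.Icub n 3 C) (Cubic.Icub n 4 C) (Cubic.Icub n 5 C)
          (Cubic.Iiso 0 C) (Cubic.Iiso 1 C) (Cubic.Iiso 2 C)) ∧
    -- and is not a polynomial in them
    ¬ Cubic.IsPolynomialIn (Cubic.Iall n) (Cubic.Jcub n 5) ∧
    -- they form a functional basis but not an integrity basis
    Cubic.IsFunctionalBasis (Cubic.groupO n) (Cubic.Iall n) ∧
    ¬ Cubic.IsIntegrityBasis (Cubic.groupO n) (Cubic.Iall n) := by
  have hnot := Cubic.not_isPolynomialIn_Jcub_sixth hn
  exact ⟨Cubic.isPolyconvex_Iall hn, Cubic.isPolynomialInvariant_Iall hn,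
    Cubic.isPolynomialIn_Jall hn, Cubic.isPolynomialIn_Iall hn,
    fun C hC => ⟨hC.trace_pos, Cubic.Jcub_sixth_eq_sixthRep hn hC⟩, hnot,
    Cubic.isFunctionalBasis_Iall hn,
    fun h => hnot (h.2 _ (Cubic.isPolynomialInvariant_Jcub_sixth hn))⟩
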